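/- Notation. $\mathcal{M}(S)^3$ denotes the $\mathbb{R}^3$-valued (finite, countably additive) Borel measures on $\mathbb{R}^3$ with support in the closed set $S\subset\mathbb{R}^3$. For $\mu\in\mathcal{M}(S)^3$, $|\mu|$ is its total variation measure, $\|\mu\|_{TV}=|\mu|(\mathbb{R}^3)$, $u_\mu=d\mu/d|\mu|$ is the Radon–Nikodym derivative, and $\mu\llcorner E$ is the restriction $B\mapsto\mu(E\cap B)$. We call $\mu$ uni-directional if $u_\mu$ is constant $|\mu|$-a.e.; two uni-directional measures $\mu,\nu$ have the same direction if there is a vector $v$ with $u_\mu=v$ $|\mu|$-a.e. and $u_\nu=v$ $|\nu|$-a.e. (so the zero measure is uni-directional, with every direction). The magnetic field generated by $\mu$ is, with $c=10^{-7}$, $$b(\mu)(x)=-c\left(\int\frac{1}{|x-y|^3}\,d\mu(y)-3\int (x-y)\frac{(x-y)\cdot d\mu(y)}{|x-y|^5}\right),\qquad x\notin\operatorname{supp}\mu,$$ and $\mu,\nu\in\mathcal{M}(S)^3$ are $S$-equivalent if $b(\mu)=b(\nu)$ on $\mathbb{R}^3\setminus S$. A closed set $S\subset\mathbb{R}^3$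 is slender if it has Lebesgue measure zero and each connected component of $\mathbb{R}^3\setminus S$ has infinite Lebesgue measure. Theorem. Let $S=\bigcup_{i=1}^n S_i$ for some pairwise disjoint closed sets $S_1,\dots,S_n$ in $\mathbb{R}^3$, and suppose that $S$ is either compact or slender. Let $\mu\in\mathcal{M}(S)^3$ be such that $\mu_i:=\mu\llcorner S_i$ is uni-directional for $i=1,\dots,n$. If $\nu\in\mathcal{M}(S)^3$ is $S$-equivalent to $\mu$, then $\nu_i:=\nu\llcorner S_i$ and $\mu_i$ are $S_i$-equivalent for $i=1,\dots,n$; moreover $$\|\mu\|_{TV}\le\|\nu\|_{TV},$$ with equality if and only if, for each $i=1,\dots,n$, $\nu_i$ is uni-directional in the same direction as $\mu_i$. Furthermore, if $S$ is slender and equality holds, then $\mu=\nu$. -/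

import Mathlib

open MeasureTheory

noncomputable section

namespace Magnetostatics

/-- Euclidean three-dimensional space, with the Euclidean norm and the Borel σ-algebra. -/
abbrev R3 : Type := EuclideanSpace ℝ (Fin 3)

/-- A magnetization on `ℝ³`: a countably additive `ℝ³`-valued Borel measure (equivalently,
a triple of finite signed Borel measures). -/
abbrev Magnetization : Type := VectorMeasure R3 R3

/-- The space `M(S)³` of magnetizations whose support, i.e. the support of the total variation
measure, lies in `S`. -/
def magnetizationsOn (S : Set R3) : Set Magnetization :=
  {μ | μ.variation.support ⊆ S}

/-- The total variation norm `‖μ‖_TV = |μ|(ℝ³)`. -/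
def tvNorm (μ : Magnetization) : ENNReal := μ.variation Set.univ

/-- The constant `c = 10⁻⁷` (in henries per metre). -/
def magneticConstant : ℝ := 1 / 10 ^ 7

/-- The magnetic field generated by `μ`,
`b(μ)(x) = -c (∫ |x - y|⁻³ dμ(y) - 3 ∫ (x - y) ((x - y) ⬝ dμ(y)) |x - y|⁻⁵)`,
at points `x` outside the support of `μ`. Here `rankOne ℝ z z` is the operator `w ↦ (z ⬝ w) z`,
and the second integral pairs an operator-valued function with the vector measure by evaluation. -/
def magneticField (μ : Magnetization) (x : R3) : R3 :=
  -magneticConstant •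
    ((∫ᵛ y, (1 / ‖x - y‖ ^ 3) ∂[ContinuousLinearMap.lsmul ℝ ℝ; μ]) -
      (3 : ℝ) • ∫ᵛ y, ((1 / ‖x - y‖ ^ 5) • InnerProductSpace.rankOne ℝ (x - y) (x - y))
        ∂[ContinuousLinearMap.id ℝ (R3 →L[ℝ] R3); μ])

/-- `S`-equivalence: the generated magnetic fields agree on `ℝ³ \ S`. -/
def SEquivalent (S : Set R3) (μ ν : Magnetization) : Prop :=
  ∀ x ∉ S, magneticField μ x = magneticField ν x

/-- A closed set is slender if it is Lebesgue-null and each connected component of its complement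
has infinite Lebesgue measure. -/
def IsSlender (S : Set R3) : Prop :=
  IsClosed S ∧ volume S = 0 ∧ ∀ x ∈ Sᶜ, volume (connectedComponentIn Sᶜ x) = ⊤

/-- The `j`-th component of a magnetization, a finite signed measure. -/
def component (μ : Magnetization) (j : Fin 3) : SignedMeasure R3 :=
  μ.mapRange ((EuclideanSpace.proj j : R3 →L[ℝ] ℝ) : R3 →+ ℝ)
    (EuclideanSpace.proj j : R3 →L[ℝ] ℝ).continuous

theorem component_apply (μ : Magnetization) (j : Fin 3) (B : Set R3) :
    component μ j B = μ B j := rfl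

/-- The Radon–Nikodym derivative `u_μ = dμ / d|μ|`, computed componentwise. -/
def polarDensity (μ : Magnetization) (x : R3) : R3 :=
  WithLp.toLp 2 fun j => (component μ j).rnDeriv μ.variation x

/-- `u_μ = v` at `|μ|`-almost every point. (The zero magnetization has every direction.) -/
def HasDirection (μ : Magnetization) (v : R3) : Prop :=
  ∀ᵐ x ∂μ.variation, polarDensity μ x = v

/-- `μ` is uni-directional: `u_μ` is constant `|μ|`-almost everywhere. -/
def IsUniDirectional (μ : Magnetization) : Prop :=
  ∃ v : R3, HasDirection μ v

/-- `μ` and `ν` are both uni-directional, with a common direction. -/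
def IsUniDirectionalSame (μ ν : Magnetization) : Prop :=
  ∃ v : R3, HasDirection μ v ∧ HasDirection ν v

end Magnetostatics

end

/-!
Off `S`, the field of `σ := ν - μ` is the convolution of `σ` with the second derivative of the
Newton kernel `1 / |x|`, and it vanishes there. The point is that the restriction of `σ` to each
`S_i` is again silent and has total moment zero.

If `S` is compact, the field of `σ⌞S_i` and minus the field of the rest of `σ` are harmonic off
disjoint compact sets and agree where both are defined, so they glue to a harmonic function on
`ℝ³` vanishing at infinity, which is zero by Liouville's theorem; the leading term of the expansion
at infinity then gives the moment. If `S` is slender, the scalar potential of `σ`, the convolution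
with the first derivative of the Newton kernel, is constant on each component of the complement of
`S`. This kernel is locally integrable and decays at infinity, so the mean of the potential over a
set of large volume is small, and on a component of infinite volume the constant is zero. Hence the
potential vanishes almost everywhere, so `σ` is divergence-free; this localizes to each `S_i`, and
gives silence and zero moment by testing.

Since `μ_i` is uni-directional, `‖μ_i‖ = |μ_i(ℝ³)| = |ν_i(ℝ³)| ≤ ‖ν_i‖`, with equality only if
`u_ν` is the direction of `μ_i`. In that case `σ⌞S_i` is a scalar measure times a vector `v`; when
it is moreover divergence-free, it is invariant under translations along `v`, so being finite it is
zero.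
-/

noncomputable section

namespace Magnetostatics

open Filter Set Metric InnerProductSpace Laplacian
open scoped ContDiff Topology Manifold

theorem exists_pos_le_norm_sub_of_mem_ball {E : Type*} [SeminormedAddCommGroup E] {T : Set E}
    {x : E} (hT : IsClosed T) (hx : x ∉ T) :
    ∃ δ > 0, ∀ x' ∈ ball x δ, ∀ y ∈ T, δ ≤ ‖x' - y‖ := by
  obtain ⟨ε, hε, hball⟩ := Metric.isOpen_iff.1 hT.isOpen_compl x hx
  refine ⟨ε / 2, half_pos hε, fun x' hx' y hy => not_lt.1 fun hlt => ?_⟩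
  refine hball (mem_ball'.2 ?_) hy
  rw [mem_ball'] at hx'
  linarith [dist_triangle x x' y, dist_eq_norm x' y]

theorem norm_kernel_apply_le {E F G : Type*} [NormedAddCommGroup E] [NormedAddCommGroup F]
    [NormedSpace ℝ F] [NormedAddCommGroup G] [NormedSpace ℝ G] {k : ℕ} {K : E → F →L[ℝ] G} {z : E}
    {C δ : ℝ} (hC : 0 ≤ C) (hKC : ∀ z ≠ 0, ‖K z‖ ≤ C / ‖z‖ ^ k)
    (hδ : 0 < δ) (hz : δ ≤ ‖z‖) (w : F) : ‖K z w‖ ≤ C / δ ^ k * ‖w‖ := by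
  refine (K z).le_of_opNorm_le ((hKC z (norm_pos_iff.1 (hδ.trans_le hz))).trans ?_) w
  gcongr

section HomogeneousKernel

variable {E G : Type*} [NormedAddCommGroup E] [NormedSpace ℝ E]
  [NormedAddCommGroup G] [NormedSpace ℝ G]
  {k : ℕ} {K : E → G} {z : E}

/-- A convolution kernel that is smooth away from the origin and positively homogeneous of degree
`-k`. Its value at the origin is irrelevant. -/
structure IsHomogeneousKernel (k : ℕ) (K : E → G) : Prop where
  contDiffOn : ContDiffOn ℝ ∞ K {0}ᶜ
  map_smul : ∀ {t : ℝ}, 0 < t → ∀ {z : E}, z ≠ 0 → K (t • z) = (t ^ k)⁻¹ • K z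

namespace IsHomogeneousKernel

theorem contDiffAt (hK : IsHomogeneousKernel k K) (hz : z ≠ 0) : ContDiffAt ℝ ∞ K z :=
  hK.contDiffOn.contDiffAt (isOpen_compl_singleton.mem_nhds hz)

theorem differentiableAt (hK : IsHomogeneousKernel k K) (hz : z ≠ 0) : DifferentiableAt ℝ K z :=
  (hK.contDiffAt hz).differentiableAt (by simp)

theorem fderiv (hK : IsHomogeneousKernel k K) : IsHomogeneousKernel (k + 1) (fderiv ℝ K) where
  contDiffOn := hK.contDiffOn.fderiv_of_isOpen isOpen_compl_singleton (by simp)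
  map_smul {t} ht z hz := by
    have hscale : (K <| t • ·) =ᶠ[𝓝 z] (t ^ k)⁻¹ • K :=
      (isOpen_compl_singleton.eventually_mem hz).mono fun y hy => hK.map_smul ht hy
    have hderiv : t • _root_.fderiv ℝ K (t • z) = (t ^ k)⁻¹ • _root_.fderiv ℝ K z := by
      rw [← fderiv_comp_smul, hscale.fderiv_eq, fderiv_const_smul (hK.differentiableAt hz)]
    rw [pow_succ', mul_inv, mul_smul, ← hderiv, inv_smul_smul₀ ht.ne']

theorem exists_norm_le [FiniteDimensional ℝ E] (hK : IsHomogeneousKernel k K) :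
    ∃ C, 0 ≤ C ∧ ∀ z ≠ 0, ‖K z‖ ≤ C / ‖z‖ ^ k := by
  have hsub : sphere (0 : E) 1 ⊆ {0}ᶜ := fun z hz => ne_of_mem_sphere hz one_ne_zero
  obtain ⟨C, hC⟩ := (isCompact_sphere (0 : E) 1).exists_bound_of_continuousOn
    (hK.contDiffOn.continuousOn.mono hsub)
  refine ⟨max C 0, le_max_right _ _, fun z hz => ?_⟩
  have hz' : 0 < ‖z‖ := norm_pos_iff.2 hz
  have hunit : ‖z‖⁻¹ • z ∈ sphere (0 : E) 1 := by
    simp [norm_smul, hz'.ne']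
  calc ‖K z‖ = ‖(‖z‖ ^ k)⁻¹ • K (‖z‖⁻¹ • z)‖ := by
        rw [← hK.map_smul hz' (hsub hunit), smul_inv_smul₀ hz'.ne']
    _ = ‖K (‖z‖⁻¹ • z)‖ / ‖z‖ ^ k := by
        rw [norm_smul, norm_inv, norm_pow, norm_norm, inv_mul_eq_div]
    _ ≤ max C 0 / ‖z‖ ^ k := by
        gcongr
        exact (hC _ hunit).trans (le_max_left _ _)

end IsHomogeneousKernel

end HomogeneousKernel

section KernelIntegral

variable {E F G : Type*} [NormedAddCommGroup E] [NormedSpace ℝ E]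
  [NormedAddCommGroup F] [NormedSpace ℝ F] [NormedAddCommGroup G] [NormedSpace ℝ G]
  {k : ℕ} {K : E → F →L[ℝ] G} {T : Set E} {x z : E}

/-- The derivative of an operator-valued kernel, with the direction of differentiation moved to the
last argument so that it is again an operator-valued kernel on the same space. -/
def flipDeriv (K : E → F →L[ℝ] G) (z : E) : F →L[ℝ] E →L[ℝ] G := (fderiv ℝ K z).flip

theorem flipDeriv_apply (K : E → F →L[ℝ] G) (z : E) (w : F) (v : E) :
    flipDeriv K z w v = fderiv ℝ K z v w := rfl

theorem isBoundedLinearMap_flip : IsBoundedLinearMap ℝ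
    (ContinuousLinearMap.flip : (E →L[ℝ] F →L[ℝ] G) → F →L[ℝ] E →L[ℝ] G) :=
  IsLinearMap.with_bound ⟨fun _ _ => rfl, fun _ _ => rfl⟩ 1 (by simp)

theorem flipDeriv_flipDeriv_apply {K : E → F →L[ℝ] G} (hK : DifferentiableAt ℝ (fderiv ℝ K) z)
    (w : F) (u v : E) :
    flipDeriv (flipDeriv K) z w u v = fderiv ℝ (fderiv ℝ K) z u v w := by
  have hflip : HasFDerivAt (flipDeriv K) _ z :=
    (isBoundedLinearMap_flip.hasFDerivAt (𝕜 := ℝ) (F := F →L[ℝ] E →L[ℝ] G)).comp z hK.hasFDerivAt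
  rw [flipDeriv_apply, hflip.fderiv]
  rfl

theorem IsHomogeneousKernel.flipDeriv (hK : IsHomogeneousKernel k K) :
    IsHomogeneousKernel (k + 1) (flipDeriv K) where
  contDiffOn := isBoundedLinearMap_flip.contDiff.comp_contDiffOn hK.fderiv.contDiffOn
  map_smul ht _ hz := by
    rw [Magnetostatics.flipDeriv, hK.fderiv.map_smul ht hz, ContinuousLinearMap.flip_smul]; rfl

variable [MeasurableSpace E]

/-- The convolution of the operator-valued kernel `K` with the vector measure `f • m`. -/
def kernelIntegral (K : E → F →L[ℝ] G) (m : Measure E) (f : E → F) (x : E) : G :=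
  ∫ y, K (x - y) (f y) ∂m

variable [FiniteDimensional ℝ E] [BorelSpace E] {m : Measure E} {f : E → F}

theorem aestronglyMeasurable_kernel (hK : ContinuousOn K {0}ᶜ) (hf : AEStronglyMeasurable f m)
    (hT : MeasurableSet T) (hm : m Tᶜ = 0) (hx : x ∉ T) :
    AEStronglyMeasurable (fun y => K (x - y) (f y)) m := by
  have hcont : ContinuousOn (fun y => K (x - y)) T :=
    hK.comp (by fun_prop) fun y hy h => hx (by rwa [sub_eq_zero.1 h])
  have hmeas := hcont.aestronglyMeasurable (μ := m) hT
  rw [Measure.restrict_eq_self_of_ae_mem (mem_ae_iff.2 hm)] at hmeas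
  exact (ContinuousLinearMap.id ℝ (F →L[ℝ] G)).aestronglyMeasurable_comp₂ hmeas hf

theorem integrable_kernel (hK : IsHomogeneousKernel k K) (hf : Integrable f m) (hT : IsClosed T)
    (hm : m Tᶜ = 0) (hx : x ∉ T) : Integrable (fun y => K (x - y) (f y)) m := by
  obtain ⟨δ, hδ, hdist⟩ := exists_pos_le_norm_sub_of_mem_ball hT hx
  obtain ⟨C, hC, hKC⟩ := hK.exists_norm_le
  have hT_ae : ∀ᵐ y ∂m, y ∈ T := mem_ae_iff.2 hm
  exact (hf.norm.const_mul (C / δ ^ k)).mono'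
    (aestronglyMeasurable_kernel hK.contDiffOn.continuousOn hf.1 hT.measurableSet hm hx)
    (hT_ae.mono fun y hy =>
      norm_kernel_apply_le hC hKC hδ (hdist x (mem_ball_self hδ) y hy) (f y))

theorem hasFDerivAt_kernelIntegral (hK : IsHomogeneousKernel k K) (hf : Integrable f m)
    (hT : IsClosed T) (hm : m Tᶜ = 0) (hx : x ∉ T) :
    HasFDerivAt (kernelIntegral K m f) (kernelIntegral (flipDeriv K) m f x) x := by
  obtain ⟨δ, hδ, hdist⟩ := exists_pos_le_norm_sub_of_mem_ball hT hx
  obtain ⟨C, hC, hKC⟩ := hK.flipDeriv.exists_norm_le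
  have hT_ae : ∀ᵐ y ∂m, y ∈ T := mem_ae_iff.2 hm
  refine hasFDerivAt_integral_of_dominated_of_fderiv_le (ball_mem_nhds x hδ)
    (F' := fun x' y => flipDeriv K (x' - y) (f y))
    (bound := fun y => C / δ ^ (k + 1) * ‖f y‖) ?_ (integrable_kernel hK hf hT hm hx)
    (integrable_kernel hK.flipDeriv hf hT hm hx).1 ?_ (hf.norm.const_mul _) ?_
  · filter_upwards [hT.isOpen_compl.mem_nhds hx] with x' hx'
    exact (integrable_kernel hK hf hT hm hx').1
  · filter_upwards [hT_ae] with y hy x' hx'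
    exact norm_kernel_apply_le hC hKC hδ (hdist x' hx' y hy) (f y)
  · filter_upwards [hT_ae] with y hy x' hx'
    have hne : x' - y ≠ 0 := norm_pos_iff.1 (hδ.trans_le (hdist x' hx' y hy))
    have hKderiv := (hK.differentiableAt hne).hasFDerivAt.comp x' (hasFDerivAt_sub_const y)
    have := ((ContinuousLinearMap.apply ℝ G (f y)).hasFDerivAt (x := K (x' - y))).comp x' hKderiv
    exact this

theorem contDiffAt_kernelIntegral_two (hK : IsHomogeneousKernel k K) (hf : Integrable f m)
    (hT : IsClosed T) (hm : m Tᶜ = 0) (hx : x ∉ T) :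
    ContDiffAt ℝ 2 (kernelIntegral K m f) x := by
  have hnhds : Tᶜ ∈ 𝓝 x := hT.isOpen_compl.mem_nhds hx
  refine contDiffAt_succ_iff_hasFDerivAt (n := 1).2 ⟨_, ⟨Tᶜ, hnhds, fun x' hx' =>
    hasFDerivAt_kernelIntegral hK hf hT hm hx'⟩, ?_⟩
  refine contDiffAt_succ_iff_hasFDerivAt (n := 0).2 ⟨_, ⟨Tᶜ, hnhds, fun x' hx' =>
    hasFDerivAt_kernelIntegral hK.flipDeriv hf hT hm hx'⟩, ?_⟩
  exact contDiffAt_zero.2 ⟨Tᶜ, hnhds, fun x' hx' => (hasFDerivAt_kernelIntegral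
    hK.flipDeriv.flipDeriv hf hT hm hx').continuousAt.continuousWithinAt⟩

end KernelIntegral

section Harmonic

variable {ι E F G : Type*} [Fintype ι] [NormedAddCommGroup E] [InnerProductSpace ℝ E]
  [FiniteDimensional ℝ E] [NormedAddCommGroup F] [NormedSpace ℝ F] [NormedAddCommGroup G]
  [NormedSpace ℝ G] {x : E}

theorem laplacian_eq_sum_fderiv_fderiv (b : OrthonormalBasis ι ℝ E) (f : E → G) (x : E) :
    Δ f x = ∑ i, fderiv ℝ (fderiv ℝ f) x (b i) (b i) := by
  simp [laplacian_eq_iteratedFDeriv_orthonormalBasis f b, iteratedFDeriv_two_apply]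

theorem laplacian_fderiv {f : E → G} (hf : ContDiffAt ℝ 3 f x) :
    Δ (fderiv ℝ f) x = fderiv ℝ (Δ f) x := by
  have hDf : ContDiffAt ℝ 2 (fderiv ℝ f) x := hf.fderiv_right (by norm_num)
  have hDDf : DifferentiableAt ℝ (fderiv ℝ (fderiv ℝ f)) x :=
    (hDf.fderiv_right (m := 1) (by norm_num)).differentiableAt (by norm_num)
  have hsymm_f : ∀ᶠ y in 𝓝 x, ∀ u v,
      fderiv ℝ (fderiv ℝ f) y u v = fderiv ℝ (fderiv ℝ f) y v u := by
    filter_upwards [hf.eventually (by simp)] with y hy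
    exact hy.isSymmSndFDerivAt (by simp; norm_num)
  have happly : ∀ u v w, fderiv ℝ (fun y => fderiv ℝ (fderiv ℝ f) y u v) x w
      = fderiv ℝ (fderiv ℝ (fderiv ℝ f)) x w u v := fun u v w => by
    have := (hDDf.hasFDerivAt.clm_apply (hasFDerivAt_const u x)).clm_apply (hasFDerivAt_const v x)
    rw [this.fderiv]
    simp
  let b := stdOrthonormalBasis ℝ E
  ext w
  rw [funext (laplacian_eq_sum_fderiv_fderiv b f), laplacian_eq_sum_fderiv_fderiv b,
    fderiv_fun_sum fun i _ =>
      (hDDf.clm_apply (differentiableAt_const _)).clm_apply (differentiableAt_const _),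
    sum_apply, sum_apply]
  refine Finset.sum_congr rfl fun i _ => ?_
  have hsymm_Df : fderiv ℝ (fderiv ℝ (fderiv ℝ f)) x (b i) w
      = fderiv ℝ (fderiv ℝ (fderiv ℝ f)) x w (b i) :=
    hDf.isSymmSndFDerivAt (by simp) (b i) w
  have hcongr : (fun y => fderiv ℝ (fderiv ℝ f) y (b i) w)
      =ᶠ[𝓝 x] fun y => fderiv ℝ (fderiv ℝ f) y w (b i) := hsymm_f.mono fun y hy => hy _ _
  rw [happly, ← hsymm_Df, ← happly, ← happly, hcongr.fderiv_eq]

theorem harmonicAt_fderiv {f : E → G} (hf : ContDiffAt ℝ 3 f x) (hΔ : HarmonicAt f x) :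
    HarmonicAt (fderiv ℝ f) x := by
  refine ⟨hf.fderiv_right (by norm_num), ?_⟩
  filter_upwards [hf.eventually (by simp), hΔ.2.eventually_nhds] with y hy hΔy
  rw [laplacian_fderiv hy, EventuallyEq.fderiv_eq hΔy]
  simp

theorem harmonicAt_flipDeriv {K : E → F →L[ℝ] G} (hK : ContDiffAt ℝ 3 K x)
    (hΔ : HarmonicAt K x) : HarmonicAt (flipDeriv K) x :=
  (HarmonicAt.comp_CLM (G := F →L[ℝ] E →L[ℝ] G) (harmonicAt_fderiv hK hΔ)
    isBoundedLinearMap_flip.toContinuousLinearMap :)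

end Harmonic

section KernelIntegralHarmonic

variable {E F G : Type*} [NormedAddCommGroup E] [InnerProductSpace ℝ E] [FiniteDimensional ℝ E]
  [MeasurableSpace E] [BorelSpace E] [NormedAddCommGroup F] [NormedSpace ℝ F]
  [NormedAddCommGroup G] [NormedSpace ℝ G] {k : ℕ} {K : E → F →L[ℝ] G} {m : Measure E}
  {f : E → F} {T : Set E} {x : E}

theorem laplacian_kernelIntegral (hK : IsHomogeneousKernel k K) (hf : Integrable f m)
    (hT : IsClosed T) (hm : m Tᶜ = 0) (hx : x ∉ T) :
    Δ (kernelIntegral K m f) x = kernelIntegral (Δ K) m f x := by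
  let b := stdOrthonormalBasis ℝ E
  have hDF : fderiv ℝ (kernelIntegral K m f) =ᶠ[𝓝 x] kernelIntegral (flipDeriv K) m f :=
    (hT.isOpen_compl.eventually_mem hx).mono fun y hy =>
      (hasFDerivAt_kernelIntegral hK hf hT hm hy).fderiv
  have hDDF := (hasFDerivAt_kernelIntegral hK.flipDeriv hf hT hm hx).fderiv
  have hint := integrable_kernel hK.flipDeriv.flipDeriv hf hT hm hx
  have hT_ae : ∀ᵐ y ∂m, y ∈ T := mem_ae_iff.2 hm
  rw [laplacian_eq_sum_fderiv_fderiv b, hDF.fderiv_eq, hDDF, kernelIntegral, kernelIntegral]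
  simp_rw [ContinuousLinearMap.integral_apply hint,
    ContinuousLinearMap.integral_apply (hint.apply_continuousLinearMap _)]
  rw [← integral_finsetSum _ fun i _ =>
    (hint.apply_continuousLinearMap (b i)).apply_continuousLinearMap (b i)]
  refine integral_congr_ae (hT_ae.mono fun y hy => ?_)
  have hne : x - y ≠ 0 := fun h => hx (by rwa [sub_eq_zero.1 h])
  simp only [flipDeriv_flipDeriv_apply (hK.fderiv.differentiableAt hne),
    laplacian_eq_sum_fderiv_fderiv b, sum_apply]

theorem harmonicOnNhd_kernelIntegral (hK : IsHomogeneousKernel k K)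
    (hΔ : HarmonicOnNhd K {0}ᶜ) (hf : Integrable f m) (hT : IsClosed T) (hm : m Tᶜ = 0) :
    HarmonicOnNhd (kernelIntegral K m f) Tᶜ := by
  intro x hx
  have hT_ae : ∀ᵐ y ∂m, y ∈ T := mem_ae_iff.2 hm
  refine ⟨contDiffAt_kernelIntegral_two hK hf hT hm hx, ?_⟩
  filter_upwards [hT.isOpen_compl.mem_nhds hx] with x' hx'
  rw [laplacian_kernelIntegral hK hf hT hm hx', Pi.zero_apply]
  refine integral_eq_zero_of_ae (hT_ae.mono fun y hy => ?_)
  have hne : x' - y ≠ 0 := fun h => hx' (by rwa [sub_eq_zero.1 h])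
  simp [(hΔ _ hne).2.self_of_nhds]

end KernelIntegralHarmonic

section Infinity

variable {E F G : Type*} [NormedAddCommGroup E] [NormedSpace ℝ E] [NormedAddCommGroup F]
  [NormedSpace ℝ F] [NormedAddCommGroup G] [NormedSpace ℝ G] {k : ℕ} {K : E → F →L[ℝ] G}
  {T : Set E} {z : E}

theorem IsHomogeneousKernel.pow_smul_apply_smul_sub (hK : IsHomogeneousKernel k K) {t : ℝ}
    (ht : 0 < t) {y : E} (h : z - t⁻¹ • y ≠ 0) (w : F) :
    t ^ k • K (t • z - y) w = K (z - t⁻¹ • y) w := by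
  have hscale : t • z - y = t • (z - t⁻¹ • y) := by rw [smul_sub, smul_inv_smul₀ ht.ne']
  rw [hscale, hK.map_smul ht h, smul_apply, smul_inv_smul₀ (pow_ne_zero k ht.ne')]

theorem eventually_half_norm_le_norm_sub (hT : Bornology.IsBounded T) (hz : z ≠ 0) :
    ∀ᶠ t : ℝ in atTop, ∀ y ∈ T, ‖z‖ / 2 ≤ ‖z - t⁻¹ • y‖ := by
  obtain ⟨R, hR⟩ := hT.exists_norm_le
  have hz' : 0 < ‖z‖ := norm_pos_iff.2 hz
  filter_upwards [eventually_gt_atTop 0, eventually_ge_atTop (2 * R / ‖z‖)] with t ht htR y hy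
  have hsmall : ‖t⁻¹ • y‖ ≤ ‖z‖ / 2 := by
    rw [norm_smul, norm_inv, Real.norm_of_nonneg ht.le, inv_mul_le_iff₀ ht]
    rw [div_le_iff₀ hz'] at htR
    linarith [hR y hy]
  linarith [norm_sub_norm_le z (t⁻¹ • y)]

variable [MeasurableSpace E] [FiniteDimensional ℝ E] {m : Measure E} {f : E → F}

theorem tendsto_kernelIntegral_cocompact (hk : k ≠ 0) (hK : IsHomogeneousKernel k K)
    (hf : Integrable f m) (hT : Bornology.IsBounded T) (hm : m Tᶜ = 0) :
    Tendsto (kernelIntegral K m f) (cocompact E) (𝓝 0) := by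
  obtain ⟨C, hC, hKC⟩ := hK.exists_norm_le
  obtain ⟨R, hR⟩ := hT.exists_norm_le
  have hT_ae : ∀ᵐ y ∂m, y ∈ T := mem_ae_iff.2 hm
  have hlim : Tendsto (fun x : E => C / (‖x‖ - R) ^ k * ∫ y, ‖f y‖ ∂m) (cocompact E) (𝓝 0) := by
    have hdist : Tendsto (fun x : E => (‖x‖ - R) ^ k) (cocompact E) atTop :=
      (tendsto_pow_atTop hk).comp
        (tendsto_atTop_add_const_right _ (-R) (tendsto_norm_cocompact_atTop (E := E)))
    simpa using (hdist.const_div_atTop C).mul_const (∫ y, ‖f y‖ ∂m)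
  refine squeeze_zero_norm' ?_ hlim
  filter_upwards [tendsto_norm_cocompact_atTop.eventually_gt_atTop R] with x hx
  rw [← integral_const_mul]
  refine norm_integral_le_of_norm_le (hf.norm.const_mul _) (hT_ae.mono fun y hy => ?_)
  refine norm_kernel_apply_le hC hKC (sub_pos.2 hx) ?_ (f y)
  linarith [hR y hy, norm_sub_norm_le x y]

theorem tendsto_pow_smul_kernelIntegral [BorelSpace E] [CompleteSpace F] [CompleteSpace G]
    (hK : IsHomogeneousKernel k K) (hf : Integrable f m) (hT : IsCompact T) (hm : m Tᶜ = 0)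
    (hz : z ≠ 0) :
    Tendsto (fun t : ℝ => t ^ k • kernelIntegral K m f (t • z)) atTop (𝓝 (K z (∫ y, f y ∂m))) := by
  obtain ⟨C, hC, hKC⟩ := hK.exists_norm_le
  have hT_ae : ∀ᵐ y ∂m, y ∈ T := mem_ae_iff.2 hm
  have hz' : 0 < ‖z‖ / 2 := half_pos (norm_pos_iff.2 hz)
  have hfar := (eventually_gt_atTop (0 : ℝ)).and
    (eventually_half_norm_le_norm_sub hT.isBounded hz)
  simp only [kernelIntegral, ← integral_smul]
  rw [← ContinuousLinearMap.integral_comp_comm _ hf]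
  refine tendsto_integral_filter_of_dominated_convergence
    (fun y => C / (‖z‖ / 2) ^ k * ‖f y‖) ?_ ?_ (hf.norm.const_mul _) ?_
  · filter_upwards [hfar] with t ⟨ht, hdist⟩
    refine ((integrable_kernel hK hf hT.isClosed hm fun htz => ?_).smul (t ^ k)).1
    have := hdist _ htz
    rw [inv_smul_smul₀ ht.ne', sub_self, norm_zero] at this
    exact this.not_gt hz'
  · filter_upwards [hfar] with t ⟨ht, hdist⟩
    filter_upwards [hT_ae] with y hy
    have hne : z - t⁻¹ • y ≠ 0 := norm_pos_iff.1 (hz'.trans_le (hdist y hy))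
    rw [hK.pow_smul_apply_smul_sub ht hne]
    exact norm_kernel_apply_le hC hKC hz' (hdist y hy) (f y)
  · filter_upwards [hT_ae] with y hy
    have hzt : Tendsto (fun t : ℝ => z - t⁻¹ • y) atTop (𝓝 z) := by
      simpa using ((tendsto_inv_atTop_zero (𝕜 := ℝ)).smul_const y).const_sub z
    have hKt : Tendsto (fun t : ℝ => K (z - t⁻¹ • y)) atTop (𝓝 (K z)) :=
      (hK.contDiffAt hz).continuousAt.tendsto.comp hzt
    refine (((ContinuousLinearMap.apply ℝ G (f y)).continuous.tendsto _).comp hKt).congr' ?_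
    filter_upwards [hfar] with t ⟨ht, hdist⟩
    have hne : z - t⁻¹ • y ≠ 0 := norm_pos_iff.1 (hz'.trans_le (hdist y hy))
    exact (hK.pow_smul_apply_smul_sub ht hne (f y)).symm

end Infinity

section Liouville

theorem deriv_deriv_nonpos_of_isLocalMax {g : ℝ → ℝ} {t : ℝ} (hg : ContinuousAt g t)
    (hmax : IsLocalMax g t) : deriv (deriv g) t ≤ 0 := by
  by_contra! hpos
  have hmin : IsLocalMin g t := isLocalMin_of_deriv_deriv_pos hpos hmax.deriv_eq_zero hg
  have hconst : g =ᶠ[𝓝 t] fun _ => g t := by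
    filter_upwards [hmin, hmax] with s hs hs' using le_antisymm hs' hs
  rw [hconst.deriv.deriv_eq] at hpos
  simp at hpos

variable {E : Type*} [NormedAddCommGroup E] [InnerProductSpace ℝ E]

theorem fderiv_fderiv_apply_self_nonpos_of_isLocalMax {f : E → ℝ} {x : E}
    (hf : ContDiffAt ℝ 2 f x) (hmax : IsLocalMax f x) (e : E) :
    fderiv ℝ (fderiv ℝ f) x e e ≤ 0 := by
  set line : ℝ → E := fun t => x + t • e with line_def
  have hline : ∀ t, HasDerivAt line e t := fun t => by
    simpa [line_def] using ((hasDerivAt_id t).smul_const e).const_add x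
  have hline_zero : line 0 = x := by simp [line_def]
  have hline_tendsto : Tendsto line (𝓝 0) (𝓝 x) := hline_zero ▸ (hline 0).continuousAt.tendsto
  have hderiv : deriv (f ∘ line) =ᶠ[𝓝 0] fun t => fderiv ℝ f (line t) e := by
    filter_upwards [hline_tendsto.eventually (hf.eventually (by simp))] with t ht
    exact ((ht.differentiableAt (by simp)).hasFDerivAt.comp_hasDerivAt t (hline t)).deriv
  have hDf : DifferentiableAt ℝ (fderiv ℝ f) (line 0) := by
    rw [hline_zero]
    exact (hf.fderiv_right (m := 1) (by norm_num)).differentiableAt (by simp)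
  have hderiv2 : deriv (deriv (f ∘ line)) 0 = fderiv ℝ (fderiv ℝ f) x e e := by
    rw [hderiv.deriv_eq]
    simpa [hline_zero] using
      ((hDf.hasFDerivAt.comp_hasDerivAt 0 (hline 0)).clm_apply (hasDerivAt_const 0 e)).deriv
  have hmax_line : IsLocalMax (f ∘ line) 0 := by
    rw [← hline_zero] at hmax
    exact (hline 0).continuousAt.tendsto.eventually hmax
  rw [← hderiv2]
  exact deriv_deriv_nonpos_of_isLocalMax
    (ContinuousAt.comp (hline_zero ▸ hf.continuousAt) (hline 0).continuousAt) hmax_line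

variable [FiniteDimensional ℝ E]

theorem laplacian_nonpos_of_isLocalMax {f : E → ℝ} {x : E} (hf : ContDiffAt ℝ 2 f x)
    (hmax : IsLocalMax f x) : Δ f x ≤ 0 := by
  rw [laplacian_eq_sum_fderiv_fderiv (stdOrthonormalBasis ℝ E)]
  exact Finset.sum_nonpos fun i _ => fderiv_fderiv_apply_self_nonpos_of_isLocalMax hf hmax _

theorem laplacian_norm_sq (x : E) :
    Δ (fun y : E => ‖y‖ ^ 2) x = 2 * Module.finrank ℝ E := by
  have hfderiv : fderiv ℝ (fun y : E => ‖y‖ ^ 2) = fun y => (2 : ℝ) • innerSL ℝ y := by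
    funext y
    rw [(hasStrictFDerivAt_norm_sq y).hasFDerivAt.fderiv, two_smul, two_smul]
  have hfderiv2 : fderiv ℝ (fun y : E => (2 : ℝ) • innerSL ℝ y) x = (2 : ℝ) • innerSL ℝ :=
    ((innerSL ℝ).hasFDerivAt.const_smul (2 : ℝ)).fderiv
  have hunit : ∀ i, innerSL ℝ (stdOrthonormalBasis ℝ E i) (stdOrthonormalBasis ℝ E i) = 1 :=
    fun i => inner_self_eq_one_of_norm_eq_one ((stdOrthonormalBasis ℝ E).norm_eq_one i)
  rw [laplacian_eq_sum_fderiv_fderiv (stdOrthonormalBasis ℝ E), hfderiv, hfderiv2]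
  simp [hunit, mul_comm]

variable [Nontrivial E]

theorem nonpos_of_harmonic_of_tendsto_cocompact {f : E → ℝ} (hf : HarmonicOnNhd f univ)
    (h0 : Tendsto f (cocompact E) (𝓝 0)) (x : E) : f x ≤ 0 := by
  by_contra! hx
  obtain ⟨r, hr⟩ := closedBall_compl_subset_of_mem_cocompact
    (h0.eventually (gt_mem_nhds (half_pos hx))) 0
  let R := max r ‖x‖ + 1
  have hRpos : 0 < R := by positivity
  let ε := f x / (4 * R ^ 2)
  have hε : 0 < ε := by positivity
  let g : E → ℝ := f + ε • fun y => ‖y‖ ^ 2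
  have hnorm_sq : ContDiff ℝ 2 fun y : E => ‖y‖ ^ 2 := contDiff_norm_sq ℝ
  have hsq : ContDiff ℝ 2 (ε • fun y : E => ‖y‖ ^ 2) := hnorm_sq.const_smul ε
  have hg : ContDiff ℝ 2 g := contDiff_iff_contDiffAt.2 fun y =>
    (hf y (mem_univ y)).1.add hsq.contDiffAt
  obtain ⟨y, hy, hmax⟩ := (isCompact_closedBall (0 : E) R).exists_isMaxOn
    ⟨0, mem_closedBall_self hRpos.le⟩ hg.continuous.continuousOn
  have hxy : f x ≤ g y := by
    refine le_trans ?_ (hmax (mem_closedBall_zero_iff.2 (by linarith [le_max_right r ‖x‖])))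
    exact le_add_of_nonneg_right (mul_nonneg hε.le (sq_nonneg ‖x‖))
  have hy_inner : ‖y‖ ≤ r := by
    by_contra! hry
    have hfy : f y < f x / 2 := hr (by simpa using hry)
    have : ε * ‖y‖ ^ 2 ≤ ε * R ^ 2 := by
      have := mem_closedBall_zero_iff.1 hy
      gcongr
    have hεR : ε * R ^ 2 = f x / 4 := by simp only [ε]; field_simp
    have : g y = f y + ε * ‖y‖ ^ 2 := rfl
    linarith
  have hlocal : IsLocalMax g y := hmax.isLocalMax
    (closedBall_mem_nhds_of_mem (mem_ball_zero_iff.2 (by linarith [le_max_left r ‖x‖])))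
  have hΔg : Δ g y = ε * (2 * Module.finrank ℝ E) := by
    rw [(hf y (mem_univ y)).1.laplacian_add hsq.contDiffAt,
      (hf y (mem_univ y)).2.self_of_nhds, laplacian_smul ε hnorm_sq.contDiffAt, laplacian_norm_sq]
    simp
  have hd : 0 < Module.finrank ℝ E := Module.finrank_pos
  exact (laplacian_nonpos_of_isLocalMax hg.contDiffAt hlocal).not_gt (hΔg ▸ by positivity)

theorem eq_zero_of_harmonic_of_tendsto_cocompact {G : Type*} [NormedAddCommGroup G]
    [NormedSpace ℝ G] {f : E → G} (hf : HarmonicOnNhd f univ)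
    (h0 : Tendsto f (cocompact E) (𝓝 0)) : f = 0 := by
  have hdual_nonpos : ∀ (L : G →L[ℝ] ℝ) x, L (f x) ≤ 0 := fun L x =>
    nonpos_of_harmonic_of_tendsto_cocompact (hf.comp_CLM L)
      (by simpa using (L.continuous.tendsto 0).comp h0) x
  refine funext fun x => SeparatingDual.eq_zero_of_forall_dual_eq_zero (R := ℝ) fun L => ?_
  exact le_antisymm (hdual_nonpos L x) (neg_nonpos.1 (hdual_nonpos (-L) x))

end Liouville

section CompactSeparation

variable {E F G : Type*} [NormedAddCommGroup E] [InnerProductSpace ℝ E] [FiniteDimensional ℝ E]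
  [NormedAddCommGroup F] [NormedSpace ℝ F] [NormedAddCommGroup G] [NormedSpace ℝ G]

/- `F₁` and `-F₂` glue to a harmonic function on the whole space. -/
theorem eqOn_zero_of_harmonic_of_add_eq_zero [Nontrivial E] {F₁ F₂ : E → G} {T₁ T₂ : Set E}
    (hT₁ : IsClosed T₁) (hT₂ : IsClosed T₂) (hdisj : Disjoint T₁ T₂)
    (hF₁ : HarmonicOnNhd F₁ T₁ᶜ) (hF₂ : HarmonicOnNhd F₂ T₂ᶜ)
    (hlim₁ : Tendsto F₁ (cocompact E) (𝓝 0)) (hlim₂ : Tendsto F₂ (cocompact E) (𝓝 0))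
    (hadd : ∀ x ∉ T₁ ∪ T₂, F₁ x + F₂ x = 0) : EqOn F₁ 0 T₁ᶜ := by
  classical
  let H : E → G := T₁.piecewise (-F₂) F₁
  have hH₁ : EqOn H F₁ T₁ᶜ := piecewise_eqOn_compl _ _ _
  have hH₂ : EqOn H (-F₂) T₂ᶜ := fun x hx => by
    by_cases hx₁ : x ∈ T₁
    · exact piecewise_eq_of_mem _ _ _ hx₁
    · exact (hH₁ hx₁).trans (eq_neg_of_add_eq_zero_left (hadd x (by simpa [hx₁] using hx)))
  have hH : HarmonicOnNhd H univ := fun x _ => by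
    by_cases hx₁ : x ∈ T₁
    · have hx₂ : x ∈ T₂ᶜ := hdisj.notMem_of_mem_left hx₁
      exact (harmonicAt_congr_nhds (hH₂.eventuallyEq_of_mem (hT₂.isOpen_compl.mem_nhds hx₂))).2
        (hF₂ x hx₂).neg
    · exact (harmonicAt_congr_nhds (hH₁.eventuallyEq_of_mem (hT₁.isOpen_compl.mem_nhds hx₁))).2
        (hF₁ x hx₁)
  have hlim : Tendsto H (cocompact E) (𝓝 0) :=
    Tendsto.if' (neg_zero (G := G) ▸ hlim₂.neg) hlim₁
  exact hH₁.symm.trans fun x _ => congrFun (eq_zero_of_harmonic_of_tendsto_cocompact hH hlim) x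

variable [MeasurableSpace E] [BorelSpace E] {k : ℕ} {K : E → F →L[ℝ] G} {m : Measure E} {f : E → F}

theorem kernelIntegral_restrict_eq_zero_of_isCompact [Nontrivial E] (hk : k ≠ 0)
    (hK : IsHomogeneousKernel k K) (hΔ : HarmonicOnNhd K {0}ᶜ) (hf : Integrable f m)
    {T₁ T₂ : Set E} (hT₁ : IsCompact T₁) (hT₂ : IsCompact T₂) (hdisj : Disjoint T₁ T₂)
    (hm : m (T₁ ∪ T₂)ᶜ = 0) (hzero : ∀ x ∉ T₁ ∪ T₂, kernelIntegral K m f x = 0) :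
    ∀ x ∉ T₁, kernelIntegral K (m.restrict T₁) f x = 0 := by
  have hnull : ∀ {T : Set E}, IsCompact T → m.restrict T Tᶜ = 0 := fun hT => by
    simp [Measure.restrict_apply hT.measurableSet.compl]
  have hlim : ∀ {T : Set E}, IsCompact T →
      Tendsto (kernelIntegral K (m.restrict T) f) (cocompact E) (𝓝 0) := fun hT =>
    tendsto_kernelIntegral_cocompact hk hK hf.integrableOn hT.isBounded (hnull hT)
  refine eqOn_zero_of_harmonic_of_add_eq_zero hT₁.isClosed hT₂.isClosed hdisj
    (harmonicOnNhd_kernelIntegral hK hΔ hf.integrableOn hT₁.isClosed (hnull hT₁))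
    (harmonicOnNhd_kernelIntegral hK hΔ hf.integrableOn hT₂.isClosed (hnull hT₂))
    (hlim hT₁) (hlim hT₂) fun x hx => ?_
  have hint := integrable_kernel hK hf (hT₁.union hT₂).isClosed hm hx
  have hconc : m.restrict (T₁ ∪ T₂) = m := Measure.restrict_eq_self_of_ae_mem (mem_ae_iff.2 hm)
  rw [← hzero x hx, kernelIntegral, kernelIntegral, kernelIntegral,
    ← setIntegral_union hdisj hT₂.measurableSet hint.integrableOn hint.integrableOn,
    hconc]

theorem kernel_apply_integral_eq_zero_of_isCompact [CompleteSpace F] [CompleteSpace G]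
    (hK : IsHomogeneousKernel k K) (hf : Integrable f m) {T : Set E} (hT : IsCompact T)
    (hm : m Tᶜ = 0) (hzero : ∀ x ∉ T, kernelIntegral K m f x = 0) {z : E} (hz : z ≠ 0) :
    K z (∫ y, f y ∂m) = 0 := by
  refine tendsto_nhds_unique (tendsto_pow_smul_kernelIntegral hK hf hT hm hz)
    (tendsto_const_nhds.congr' ?_)
  filter_upwards [eventually_gt_atTop 0,
    eventually_half_norm_le_norm_sub hT.isBounded hz] with t ht hdist
  rw [hzero, smul_zero]
  intro htz
  have := hdist _ htz
  rw [inv_smul_smul₀ ht.ne', sub_self, norm_zero] at this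
  exact this.not_gt (half_pos (norm_pos_iff.2 hz))

end CompactSeparation

section NewtonKernel

variable {E : Type*} [NormedAddCommGroup E] {ε : ℝ} {z : E}

/-- The norm smoothed at scale `ε`; for `ε = 0` it is the norm itself. -/
def softNorm (ε : ℝ) (z : E) : ℝ := √(‖z‖ ^ 2 + ε ^ 2)

/-- The Newton kernel in dimension three, smoothed at scale `ε`. The Newton kernel `‖z‖⁻¹` itself
is `newtonKernel 0`; keeping `ε` in one formula gives its derivatives and those of its smoothings
at once. -/
def newtonKernel (ε : ℝ) (z : E) : ℝ := (softNorm ε z)⁻¹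

theorem softNorm_zero (z : E) : softNorm 0 z = ‖z‖ := by simp [softNorm]

theorem sq_softNorm (ε : ℝ) (z : E) : softNorm ε z ^ 2 = ‖z‖ ^ 2 + ε ^ 2 :=
  Real.sq_sqrt (by positivity)

theorem norm_le_softNorm (ε : ℝ) (z : E) : ‖z‖ ≤ softNorm ε z :=
  Real.le_sqrt_of_sq_le (le_add_of_nonneg_right (sq_nonneg ε))

theorem softNorm_pos (h : ε ≠ 0 ∨ z ≠ 0) : 0 < softNorm ε z := by
  rcases h with h | h <;> exact Real.sqrt_pos.2 (by positivity)

theorem softNorm_smul [NormedSpace ℝ E] {t : ℝ} (ht : 0 ≤ t) (ε : ℝ) (z : E) :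
    softNorm (t * ε) (t • z) = t * softNorm ε z := by
  rw [softNorm, norm_smul, Real.norm_of_nonneg ht, mul_pow, mul_pow, ← mul_add,
    Real.sqrt_mul (sq_nonneg t), Real.sqrt_sq ht, softNorm]

theorem continuous_softNorm_left (z : E) : Continuous fun ε => softNorm ε z := by
  unfold softNorm; fun_prop

theorem continuous_softNorm (ε : ℝ) : Continuous (softNorm ε : E → ℝ) := by
  unfold softNorm; fun_prop

variable [InnerProductSpace ℝ E]

theorem contDiffAt_newtonKernel (hz : 0 < softNorm ε z) :
    ContDiffAt ℝ ∞ (newtonKernel ε) z :=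
  (((contDiff_norm_sq ℝ).contDiffAt.add contDiffAt_const).sqrt
    (Real.sqrt_pos.1 hz).ne').inv hz.ne'

theorem hasFDerivAt_softNorm (hz : 0 < softNorm ε z) :
    HasFDerivAt (softNorm ε) ((softNorm ε z)⁻¹ • innerSL ℝ z) z := by
  have := ((hasStrictFDerivAt_norm_sq z).hasFDerivAt.add_const (ε ^ 2)).sqrt
    (Real.sqrt_pos.1 hz).ne'
  refine this.congr_fderiv ?_
  rw [← Nat.cast_smul_eq_nsmul ℝ, smul_smul, softNorm]
  congr 1
  field_simp
  norm_num

theorem fderiv_newtonKernel (hz : 0 < softNorm ε z) :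
    fderiv ℝ (newtonKernel ε) z = -(softNorm ε z ^ 3)⁻¹ • innerSL ℝ z := by
  have := (hasDerivAt_inv hz.ne').comp_hasFDerivAt z (hasFDerivAt_softNorm hz)
  refine this.fderiv.trans ?_
  rw [smul_smul]
  congr 1
  field_simp

theorem fderiv_newtonKernel_apply (hz : 0 < softNorm ε z) (w : E) :
    fderiv ℝ (newtonKernel ε) z w = -(inner ℝ z w / softNorm ε z ^ 3) := by
  rw [fderiv_newtonKernel hz, smul_apply, innerSL_apply_apply, smul_eq_mul]
  ring

theorem abs_fderiv_newtonKernel_apply_le (hz : z ≠ 0) (w : E) :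
    |fderiv ℝ (newtonKernel ε) z w| ≤ (‖z‖ ^ 2)⁻¹ * ‖w‖ := by
  have := norm_pos_iff.2 hz
  have hsoft : 0 < softNorm ε z := softNorm_pos (.inr hz)
  rw [fderiv_newtonKernel_apply hsoft, abs_neg, abs_div, abs_of_nonneg (pow_nonneg hsoft.le 3)]
  calc |inner ℝ z w| / softNorm ε z ^ 3 ≤ ‖z‖ * ‖w‖ / ‖z‖ ^ 3 := by
        gcongr
        · exact abs_real_inner_le_norm z w
        · exact norm_le_softNorm ε z
    _ = (‖z‖ ^ 2)⁻¹ * ‖w‖ := by field_simp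

theorem fderiv_fderiv_newtonKernel_apply (hz : 0 < softNorm ε z) (u v : E) :
    fderiv ℝ (fderiv ℝ (newtonKernel ε)) z u v =
      3 * (inner ℝ z u * inner ℝ z v) / softNorm ε z ^ 5 - inner ℝ u v / softNorm ε z ^ 3 := by
  have heq : fderiv ℝ (newtonKernel ε) =ᶠ[𝓝 z] fun y => -(softNorm ε y ^ 3)⁻¹ • innerSL ℝ y :=
    ((isOpen_lt continuous_const (continuous_softNorm ε)).eventually_mem hz).mono
      fun y hy => fderiv_newtonKernel hy
  have hcoeff : HasFDerivAt (fun y : E => -(softNorm ε y ^ 3)⁻¹)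
      ((3 / softNorm ε z ^ 5) • innerSL ℝ z) z := by
    have := ((hasDerivAt_inv (pow_pos hz 3).ne').comp_hasFDerivAt z
      ((hasFDerivAt_softNorm hz).pow 3)).neg
    refine this.congr_fderiv ?_
    ext v
    simp
    field_simp
  have := (hcoeff.smul (innerSL ℝ (E := E)).hasFDerivAt).fderiv
  rw [heq.fderiv_eq]
  refine (congrArg (fun L : E →L[ℝ] E →L[ℝ] ℝ => L u v) this).trans ?_
  change -(softNorm ε z ^ 3)⁻¹ * inner ℝ u v + 3 / softNorm ε z ^ 5 * inner ℝ z u * inner ℝ z v = _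
  ring

theorem laplacian_newtonKernel [FiniteDimensional ℝ E] (hE : Module.finrank ℝ E = 3)
    (hz : 0 < softNorm ε z) :
    Δ (newtonKernel ε : E → ℝ) z = -(3 * ε ^ 2 / softNorm ε z ^ 5) := by
  let b := stdOrthonormalBasis ℝ E
  have hparseval : ∑ i, inner ℝ z (b i) ^ 2 = softNorm ε z ^ 2 - ε ^ 2 := by
    rw [b.sum_sq_inner_left, sq_softNorm, add_sub_cancel_right]
  have hb : ∀ i, inner ℝ (b i) (b i) = 1 := fun i =>
    inner_self_eq_one_of_norm_eq_one (b.norm_eq_one i)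
  simp only [laplacian_eq_sum_fderiv_fderiv b, fderiv_fderiv_newtonKernel_apply hz, hb, ← sq,
    Finset.sum_sub_distrib, ← Finset.sum_div, ← Finset.mul_sum, hparseval]
  simp only [Finset.sum_const, Finset.card_univ, Fintype.card_fin, hE]
  field_simp
  ring

theorem isHomogeneousKernel_newtonKernel :
    IsHomogeneousKernel 1 (newtonKernel 0 : E → ℝ) where
  contDiffOn z hz := (contDiffAt_newtonKernel (softNorm_pos (.inr hz))).contDiffWithinAt
  map_smul {t} ht z _ := by
    rw [newtonKernel, newtonKernel, ← mul_zero t, softNorm_smul ht.le, mul_zero, mul_inv, pow_one,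
      smul_eq_mul]

theorem isHomogeneousKernel_fderiv_newtonKernel :
    IsHomogeneousKernel 2 (fderiv ℝ (newtonKernel 0 : E → ℝ)) :=
  isHomogeneousKernel_newtonKernel.fderiv

theorem harmonicOnNhd_newtonKernel [FiniteDimensional ℝ E] (hE : Module.finrank ℝ E = 3) :
    HarmonicOnNhd (newtonKernel 0 : E → ℝ) {0}ᶜ := fun z hz => by
  refine ⟨(contDiffAt_newtonKernel (softNorm_pos (.inr hz))).of_le (by norm_cast), ?_⟩
  filter_upwards [isOpen_compl_singleton.mem_nhds hz] with y hy
  simp [laplacian_newtonKernel hE (softNorm_pos (.inr hy))]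

end NewtonKernel

section WeaklySingular

theorem inv_norm_pow_le_indicator_add {E : Type*} [SeminormedAddCommGroup E] (k : ℕ) (z : E)
    {r : ℝ} (hr : 0 < r) :
    (‖z‖ ^ k)⁻¹ ≤ (ball 0 r).indicator (fun z => (‖z‖ ^ k)⁻¹) z + (r ^ k)⁻¹ := by
  by_cases hz : z ∈ ball 0 r
  · rw [indicator_of_mem hz]
    exact le_add_of_nonneg_right (by positivity)
  · rw [indicator_of_notMem hz, zero_add]
    rw [mem_ball_zero_iff, not_lt] at hz
    gcongr

variable {E F G : Type*} [NormedAddCommGroup E] [NormedSpace ℝ E] {k : ℕ}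

theorem nontrivial_of_lt_finrank (hk : k < Module.finrank ℝ E) : Nontrivial E :=
  Module.nontrivial_of_finrank_pos (R := ℝ) (k.zero_le.trans_lt hk)

variable [FiniteDimensional ℝ E] [MeasurableSpace E] [BorelSpace E] {μ : Measure E}
  [μ.IsAddHaarMeasure]

theorem integrableOn_ball_inv_norm_pow (hk : k < Module.finrank ℝ E) (r : ℝ) :
    IntegrableOn (fun z : E => (‖z‖ ^ k)⁻¹) (ball 0 r) μ := by
  have := nontrivial_of_lt_finrank hk
  refine (integrableOn_fun_norm_addHaar μ (f := fun t : ℝ => (t ^ k)⁻¹)).2 ?_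
  have hcont : Continuous fun t : ℝ => t ^ (Module.finrank ℝ E - 1 - k) := by fun_prop
  refine ((hcont.integrableOn_Icc (a := 0) (b := r)).mono_set Ioo_subset_Icc_self).congr_fun
    (fun t ht => ?_) measurableSet_Ioo
  have hexp : Module.finrank ℝ E - 1 = Module.finrank ℝ E - 1 - k + k := by lia
  have := ht.1.ne'
  simp only [smul_eq_mul]
  rw [hexp, Nat.add_sub_cancel, pow_add]
  field_simp

theorem locallyIntegrable_inv_norm_pow (hk : k < Module.finrank ℝ E) :
    LocallyIntegrable (fun z : E => (‖z‖ ^ k)⁻¹) μ := by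
  refine locallyIntegrable_iff.2 fun T hT => ?_
  obtain ⟨r, hr⟩ := hT.isBounded.subset_ball 0
  exact (integrableOn_ball_inv_norm_pow hk r).mono_set hr

variable [NormedAddCommGroup F] [NormedSpace ℝ F] [NormedAddCommGroup G] [NormedSpace ℝ G]
  {K : E → F →L[ℝ] G}

theorem exists_enorm_kernel_le (hk₀ : k ≠ 0) (hk : k < Module.finrank ℝ E)
    (hK : IsHomogeneousKernel k K) {ε : ℝ} (hε : 0 < ε) :
    ∃ g : E → ENNReal, Measurable g ∧ ∫⁻ z, g z ∂μ ≠ ⊤ ∧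
      ∀ z ≠ 0, ‖K z‖ₑ ≤ g z + ENNReal.ofReal ε := by
  obtain ⟨C, hC, hKC⟩ := hK.exists_norm_le
  obtain ⟨r, hr, hCr⟩ : ∃ r : ℝ, 0 < r ∧ C * (r ^ k)⁻¹ < ε := by
    have hlim : Tendsto (fun r : ℝ => C * (r ^ k)⁻¹) atTop (𝓝 0) := by
      simpa using (tendsto_pow_atTop hk₀).inv_tendsto_atTop.const_mul C
    exact ((eventually_gt_atTop 0).and (hlim.eventually_lt_const hε)).exists
  set near : E → ℝ := (ball 0 r).indicator fun z => (‖z‖ ^ k)⁻¹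
  have hnear : Integrable near μ :=
    (integrableOn_ball_inv_norm_pow hk r).integrable_indicator measurableSet_ball
  have hmeas : Measurable near := Measurable.indicator (by fun_prop) measurableSet_ball
  refine ⟨fun z => ENNReal.ofReal (C * near z), (hmeas.const_mul C).ennreal_ofReal,
    (hnear.const_mul C).lintegral_lt_top.ne, fun z hz => ?_⟩
  rw [← ofReal_norm]
  refine (ENNReal.ofReal_le_ofReal ?_).trans ENNReal.ofReal_add_le
  calc ‖K z‖ ≤ C * (‖z‖ ^ k)⁻¹ := (hKC z hz).trans_eq (div_eq_mul_inv _ _)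
    _ ≤ C * (near z + (r ^ k)⁻¹) := by
        gcongr
        exact inv_norm_pow_le_indicator_add k z hr
    _ ≤ C * near z + ε := by linarith

theorem exists_lintegral_enorm_kernel_le (hk₀ : k ≠ 0) (hk : k < Module.finrank ℝ E)
    (hK : IsHomogeneousKernel k K) {ε : ℝ} (hε : 0 < ε) :
    ∃ J ≠ ⊤, ∀ (A : Set E) (y : E) (w : F),
      ∫⁻ x in A, ‖K (x - y) w‖ₑ ∂μ ≤ (J + ENNReal.ofReal ε * μ A) * ‖w‖ₑ := by
  have := nontrivial_of_lt_finrank hk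
  obtain ⟨g, hg, hgtop, hKg⟩ := exists_enorm_kernel_le (μ := μ) hk₀ hk hK hε
  refine ⟨∫⁻ z, g z ∂μ, hgtop, fun A y w => ?_⟩
  have hgy : Measurable fun x => g (x - y) := by fun_prop
  have hne : ∀ᵐ x ∂μ.restrict A, x ≠ y := ae_restrict_of_ae (Measure.ae_ne μ y)
  calc ∫⁻ x in A, ‖K (x - y) w‖ₑ ∂μ
      ≤ ∫⁻ x in A, (g (x - y) + ENNReal.ofReal ε) * ‖w‖ₑ ∂μ := by
        refine lintegral_mono_ae (hne.mono fun x hx => ?_)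
        exact ((K (x - y)).le_opENorm w).trans
          (mul_le_mul_left (hKg _ (sub_ne_zero.2 hx)) _)
    _ = (∫⁻ x in A, g (x - y) ∂μ + ENNReal.ofReal ε * μ A) * ‖w‖ₑ := by
        rw [lintegral_mul_const _ (hgy.add_const _), lintegral_add_left hgy, setLIntegral_const]
    _ ≤ (∫⁻ z, g z ∂μ + ENNReal.ofReal ε * μ A) * ‖w‖ₑ := by
        refine mul_le_mul_left (add_le_add_left ?_ _) _
        exact (setLIntegral_le_lintegral A _).trans_eq (lintegral_sub_right_eq_self g y)

theorem IsHomogeneousKernel.aestronglyMeasurable [Nontrivial E]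
    (hK : IsHomogeneousKernel k K) : AEStronglyMeasurable K μ := by
  have := hK.contDiffOn.continuousOn.aestronglyMeasurable (μ := μ)
    (measurableSet_singleton (0 : E)).compl
  rwa [Measure.restrict_eq_self_of_ae_mem] at this
  exact Measure.ae_ne μ 0

variable {m : Measure E} [SFinite m] {f : E → F}

theorem aestronglyMeasurable_kernel_prod [Nontrivial E] (hK : IsHomogeneousKernel k K)
    (hf : AEStronglyMeasurable f m) :
    AEStronglyMeasurable (fun p : E × E => K (p.1 - p.2) (f p.2)) (μ.prod m) :=
  (ContinuousLinearMap.id ℝ (F →L[ℝ] G)).aestronglyMeasurable_comp₂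
    (hK.aestronglyMeasurable.comp_quasiMeasurePreserving
      (quasiMeasurePreserving_sub_of_right_invariant μ m)) hf.comp_snd

theorem exists_lintegral_prod_enorm_kernel_le (hk₀ : k ≠ 0) (hk : k < Module.finrank ℝ E)
    (hK : IsHomogeneousKernel k K) (hf : AEStronglyMeasurable f m) {ε : ℝ} (hε : 0 < ε) :
    ∃ J ≠ ⊤, ∀ A : Set E, ∫⁻ p, ‖K (p.1 - p.2) (f p.2)‖ₑ ∂(μ.restrict A).prod m ≤
      (J + ENNReal.ofReal ε * μ A) * ∫⁻ y, ‖f y‖ₑ ∂m := by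
  have := nontrivial_of_lt_finrank hk
  obtain ⟨J, hJ, hle⟩ := exists_lintegral_enorm_kernel_le (μ := μ) hk₀ hk hK hε
  refine ⟨J, hJ, fun A => ?_⟩
  have hmeas : AEStronglyMeasurable (fun p : E × E => K (p.1 - p.2) (f p.2))
      ((μ.restrict A).prod m) :=
    (aestronglyMeasurable_kernel_prod hK hf).mono_measure
      (Measure.prod_mono Measure.restrict_le_self le_rfl)
  rw [lintegral_prod_symm _ hmeas.enorm, ← lintegral_const_mul'' _ hf.enorm]
  exact lintegral_mono fun y => hle A y (f y)

theorem integrable_kernel_prod (hk₀ : k ≠ 0) (hk : k < Module.finrank ℝ E)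
    (hK : IsHomogeneousKernel k K) (hf : Integrable f m) {A : Set E} (hA : μ A ≠ ⊤) :
    Integrable (fun p : E × E => K (p.1 - p.2) (f p.2)) ((μ.restrict A).prod m) := by
  have := nontrivial_of_lt_finrank hk
  obtain ⟨J, hJ, hle⟩ := exists_lintegral_prod_enorm_kernel_le (μ := μ) hk₀ hk hK hf.1 one_pos
  refine ⟨(aestronglyMeasurable_kernel_prod hK hf.1).mono_measure
    (Measure.prod_mono Measure.restrict_le_self le_rfl), (hle A).trans_lt ?_⟩
  have := hf.2.ne
  finiteness

theorem exists_setLIntegral_enorm_kernelIntegral_le (hk₀ : k ≠ 0) (hk : k < Module.finrank ℝ E)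
    (hK : IsHomogeneousKernel k K) (hf : AEStronglyMeasurable f m) {ε : ℝ} (hε : 0 < ε) :
    ∃ J ≠ ⊤, ∀ A : Set E, ∫⁻ x in A, ‖kernelIntegral K m f x‖ₑ ∂μ ≤
      (J + ENNReal.ofReal ε * μ A) * ∫⁻ y, ‖f y‖ₑ ∂m := by
  have := nontrivial_of_lt_finrank hk
  obtain ⟨J, hJ, hle⟩ := exists_lintegral_prod_enorm_kernel_le (μ := μ) hk₀ hk hK hf hε
  refine ⟨J, hJ, fun A => le_trans ?_ (hle A)⟩
  rw [lintegral_prod _ ((aestronglyMeasurable_kernel_prod hK hf).mono_measure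
    (Measure.prod_mono Measure.restrict_le_self le_rfl)).enorm]
  exact lintegral_mono fun x => enorm_integral_le_lintegral_enorm _

theorem eq_zero_of_kernelIntegral_eq_const (hk₀ : k ≠ 0) (hk : k < Module.finrank ℝ E)
    (hK : IsHomogeneousKernel k K) (hf : Integrable f m) {A : Set E} (hA : MeasurableSet A)
    (hAtop : μ A = ⊤) {c : G} (hc : ∀ x ∈ A, kernelIntegral K m f x = c) : c = 0 := by
  by_contra hc₀
  have hcpos : 0 < ‖c‖ := norm_pos_iff.2 hc₀
  set M := (∫⁻ y, ‖f y‖ₑ ∂m).toReal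
  have : 0 ≤ M := ENNReal.toReal_nonneg
  have hεM : ‖c‖ / (2 * (M + 1)) * M ≤ ‖c‖ / 2 := by
    rw [div_mul_eq_mul_div, div_le_div_iff₀ (by positivity) two_pos]
    nlinarith
  obtain ⟨J, hJ, hle⟩ := exists_setLIntegral_enorm_kernelIntegral_le (μ := μ) hk₀ hk hK hf.1
    (ε := ‖c‖ / (2 * (M + 1))) (by positivity)
  obtain ⟨B, hB, hBA, hlarge, hBtop⟩ := Measure.exists_subset_measure_lt_top hA
    (r := ENNReal.ofReal (2 * (J.toReal * M) / ‖c‖)) (hAtop ▸ ENNReal.ofReal_lt_top)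
  have hbound : ‖c‖ₑ * μ B ≤
      (J + ENNReal.ofReal (‖c‖ / (2 * (M + 1))) * μ B) * ∫⁻ y, ‖f y‖ₑ ∂m := by
    refine le_of_eq_of_le ?_ (hle B)
    rw [← setLIntegral_const]
    exact setLIntegral_congr_fun hB fun x hx => by rw [hc x (hBA hx)]
  have hfin := hf.2.ne
  have hreal := ENNReal.toReal_mono (by finiteness) hbound
  rw [ENNReal.toReal_mul, ENNReal.toReal_mul, ENNReal.toReal_add hJ (by finiteness),
    ENNReal.toReal_mul, toReal_enorm, ENNReal.toReal_ofReal (by positivity)] at hreal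
  rw [ENNReal.ofReal_lt_iff_lt_toReal (by positivity) hBtop.ne, div_lt_iff₀ hcpos] at hlarge
  nlinarith [mul_le_mul_of_nonneg_right hεM (μ B).toReal_nonneg]

end WeaklySingular

section Green

theorem integral_fderiv_mul_eq_neg {E : Type*} [NormedAddCommGroup E] [NormedSpace ℝ E]
    [FiniteDimensional ℝ E] [MeasurableSpace E] [BorelSpace E] {μ : Measure E}
    [μ.IsAddHaarMeasure] {φ g : E → ℝ} (hφ : ContDiff ℝ 1 φ) (hs : HasCompactSupport φ)
    (hg : ContDiff ℝ 1 g) (v : E) :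
    ∫ x, fderiv ℝ φ x v * g x ∂μ = -∫ x, φ x * fderiv ℝ g x v ∂μ := by
  have hφ' : Continuous fun x => fderiv ℝ φ x v :=
    (hφ.continuous_fderiv one_ne_zero).clm_apply continuous_const
  have hg' : Continuous fun x => fderiv ℝ g x v :=
    (hg.continuous_fderiv one_ne_zero).clm_apply continuous_const
  rw [integral_mul_fderiv_eq_neg_fderiv_mul_of_integrable
    ((hφ'.mul hg.continuous).integrable_of_hasCompactSupport (hs.fderiv_apply ℝ v).mul_right)
    ((hφ.continuous.mul hg').integrable_of_hasCompactSupport hs.mul_right)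
    ((hφ.continuous.mul hg.continuous).integrable_of_hasCompactSupport hs.mul_right)
    (fun x _ => hφ.differentiable one_ne_zero x) (fun x _ => hg.differentiable one_ne_zero x),
    neg_neg]

variable {E : Type*} [NormedAddCommGroup E] [InnerProductSpace ℝ E] [FiniteDimensional ℝ E]
  {φ g : E → ℝ}

theorem laplacian_comp_add_right (φ : E → ℝ) (y x : E) :
    Δ (fun x => φ (x + y)) x = Δ φ (x + y) := by
  have hD : fderiv ℝ (fun x => φ (x + y)) = fun x => fderiv ℝ φ (x + y) :=
    funext fun x => fderiv_comp_add_right y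
  rw [laplacian_eq_sum_fderiv_fderiv (stdOrthonormalBasis ℝ E),
    laplacian_eq_sum_fderiv_fderiv (stdOrthonormalBasis ℝ E), hD]
  simp only [fderiv_comp_add_right (f := fderiv ℝ φ)]

theorem fderiv_laplacian_apply (hφ : ContDiff ℝ 3 φ) (w x : E) :
    fderiv ℝ (Δ φ) x w = Δ (fun x => fderiv ℝ φ x w) x := by
  rw [← laplacian_fderiv hφ.contDiffAt]
  have hDφ : ContDiffAt ℝ 2 (fderiv ℝ φ) x := hφ.contDiffAt.fderiv_right (by norm_num)
  exact (hDφ.laplacian_CLM_comp_left (l := ContinuousLinearMap.apply ℝ ℝ w)).symm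

theorem contDiff_laplacian {n : WithTop ℕ∞} (hφ : ContDiff ℝ (n + 2) φ) : ContDiff ℝ n (Δ φ) := by
  rw [funext (laplacian_eq_sum_fderiv_fderiv (stdOrthonormalBasis ℝ E) φ)]
  have hD : ContDiff ℝ (n + 1) (fderiv ℝ φ) :=
    hφ.fderiv_right (by rw [add_assoc, one_add_one_eq_two])
  exact ContDiff.sum fun i _ =>
    ((hD.fderiv_right le_rfl).clm_apply contDiff_const).clm_apply contDiff_const

theorem hasCompactSupport_laplacian (hs : HasCompactSupport φ) : HasCompactSupport (Δ φ) := by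
  refine ((hs.fderiv ℝ).fderiv ℝ).mono fun x hx => ?_
  contrapose! hx
  rw [Function.notMem_support] at hx ⊢
  simp [laplacian_eq_sum_fderiv_fderiv (stdOrthonormalBasis ℝ E), hx]

variable [MeasurableSpace E] [BorelSpace E] {μ : Measure E} [μ.IsAddHaarMeasure]

theorem integral_laplacian_mul_eq (hφ : ContDiff ℝ 2 φ) (hs : HasCompactSupport φ)
    (hg : ContDiff ℝ 2 g) : ∫ x, Δ φ x * g x ∂μ = ∫ x, φ x * Δ g x ∂μ := by
  let b := stdOrthonormalBasis ℝ E
  have hC1 {h : E → ℝ} (hh : ContDiff ℝ 2 h) (v : E) : ContDiff ℝ 1 fun x => fderiv ℝ h x v :=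
    (hh.fderiv_right (by norm_num)).clm_apply contDiff_const
  have hC0 {h : E → ℝ} (hh : ContDiff ℝ 2 h) (v : E) :
      Continuous fun x => fderiv ℝ (fun x => fderiv ℝ h x v) x v :=
    ((hC1 hh v).continuous_fderiv one_ne_zero).clm_apply continuous_const
  have hsum {h : E → ℝ} (hh : ContDiff ℝ 2 h) (x : E) :
      Δ h x = ∑ i, fderiv ℝ (fun x => fderiv ℝ h x (b i)) x (b i) := by
    have hDh : DifferentiableAt ℝ (fderiv ℝ h) x :=
      (hh.fderiv_right (m := 1) (by norm_num)).differentiable one_ne_zero x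
    rw [laplacian_eq_sum_fderiv_fderiv b]
    refine Finset.sum_congr rfl fun i _ => ?_
    rw [fderiv_clm_apply hDh (differentiableAt_const _)]
    simp
  simp only [hsum hφ, hsum hg, Finset.sum_mul, Finset.mul_sum]
  rw [integral_finsetSum, integral_finsetSum]
  · refine Finset.sum_congr rfl fun i _ => ?_
    rw [integral_fderiv_mul_eq_neg (hC1 hφ _) (hs.fderiv_apply ℝ _) (hg.of_le one_le_two),
      integral_fderiv_mul_eq_neg (hφ.of_le one_le_two) hs (hC1 hg _), neg_neg]
  · exact fun i _ => (hφ.continuous.mul (hC0 hg _)).integrable_of_hasCompactSupport hs.mul_right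
  · exact fun i _ => ((hC0 hφ _).mul hg.continuous).integrable_of_hasCompactSupport
      ((hs.fderiv_apply ℝ _).fderiv_apply ℝ _).mul_right

theorem integral_laplacian_mul_fderiv_eq_neg (hφ : ContDiff ℝ 3 φ) (hs : HasCompactSupport φ)
    (hg : ContDiff ℝ 2 g) (w : E) :
    ∫ x, Δ φ x * fderiv ℝ g x w ∂μ = -∫ x, fderiv ℝ φ x w * Δ g x ∂μ := by
  have hDφ : ContDiff ℝ 2 fun x => fderiv ℝ φ x w :=
    (hφ.fderiv_right (by norm_num)).clm_apply contDiff_const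
  have hΔφ : ContDiff ℝ 1 (Δ φ) := contDiff_laplacian (hφ.of_le (by norm_num))
  rw [← integral_laplacian_mul_eq hDφ (hs.fderiv_apply ℝ w) hg,
    ← neg_eq_iff_eq_neg, ← integral_fderiv_mul_eq_neg hΔφ (hasCompactSupport_laplacian hs)
      (hg.of_le one_le_two) w]
  simp only [fderiv_laplacian_apply hφ]

end Green

section FundamentalSolution

variable {E : Type*} [NormedAddCommGroup E] [InnerProductSpace ℝ E] [FiniteDimensional ℝ E]
  [MeasurableSpace E] [BorelSpace E] {μ : Measure E} [μ.IsAddHaarMeasure] {φ ψ : E → ℝ}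

theorem integrable_inv_softNorm_one_pow_five (hE : Module.finrank ℝ E = 3) :
    Integrable (fun z : E => 3 / softNorm 1 z ^ 5) μ := by
  have hJapanese := (integrable_rpow_neg_one_add_norm_sq (E := E) (μ := μ) (r := 5)
    (by rw [hE]; norm_num)).const_mul 3
  refine hJapanese.congr (Eventually.of_forall fun z => ?_)
  simp only [softNorm]
  rw [Real.sqrt_eq_rpow, ← Real.rpow_mul_natCast (by positivity), neg_div,
    Real.rpow_neg (by positivity), ← div_eq_mul_inv]
  congr 2
  · ring
  · norm_num

/-- The mass of `-Δ (newtonKernel 1)`. Smoothing at another scale does not change it, so it is the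
mass that `-Δ (newtonKernel 0)` carries at the origin. -/
def newtonConstant (μ : Measure E) : ℝ := ∫ z, 3 / softNorm 1 z ^ 5 ∂μ

theorem newtonConstant_pos (hE : Module.finrank ℝ E = 3) : 0 < newtonConstant μ := by
  have hpos (z : E) : 0 < 3 / softNorm 1 z ^ 5 :=
    div_pos three_pos (pow_pos (softNorm_pos (.inl one_ne_zero)) 5)
  refine (integral_pos_iff_support_of_nonneg (fun z => (hpos z).le)
    (integrable_inv_softNorm_one_pow_five hE)).2 ?_
  rw [Function.support_eq_univ fun z => (hpos z).ne']
  exact Measure.measure_univ_pos.2 (NeZero.ne μ)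

theorem integral_mul_inv_softNorm_pow_five_eq (hE : Module.finrank ℝ E = 3) {ε : ℝ} (hε : 0 < ε)
    (ψ : E → ℝ) :
    ∫ x, ψ x * (3 * ε ^ 2 / softNorm ε x ^ 5) ∂μ = ∫ z, ψ (ε • z) * (3 / softNorm 1 z ^ 5) ∂μ := by
  have hscale := Measure.integral_comp_smul_of_nonneg μ
    (fun x => ψ x * (3 * ε ^ 2 / softNorm ε x ^ 5)) ε (hR := hε.le)
  rw [hE, smul_eq_mul, eq_comm, inv_mul_eq_iff_eq_mul₀ (by positivity)] at hscale
  rw [hscale, ← integral_const_mul]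
  congr 1 with z
  have hsoft : softNorm ε (ε • z) = ε * softNorm 1 z := by
    simpa using softNorm_smul hε.le 1 z
  have := (softNorm_pos (z := z) (.inl one_ne_zero)).ne'
  rw [hsoft]
  field_simp

theorem tendsto_integral_mul_inv_softNorm_pow_five (hE : Module.finrank ℝ E = 3)
    (hψ : Continuous ψ) (hs : HasCompactSupport ψ) :
    Tendsto (fun ε : ℝ => ∫ x, ψ x * (3 * ε ^ 2 / softNorm ε x ^ 5) ∂μ) (𝓝[>] 0)
      (𝓝 (ψ 0 * newtonConstant μ)) := by
  obtain ⟨M, hM⟩ := hψ.bounded_above_of_compact_support hs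
  have hpos (z : E) : 0 ≤ 3 / softNorm 1 z ^ 5 := div_nonneg three_pos.le
    (pow_pos (softNorm_pos (.inl one_ne_zero)) 5).le
  have hint := integrable_inv_softNorm_one_pow_five (μ := μ) hE
  have hlim : Tendsto (fun ε : ℝ => ∫ z, ψ (ε • z) * (3 / softNorm 1 z ^ 5) ∂μ) (𝓝[>] 0)
      (𝓝 (∫ z, ψ 0 * (3 / softNorm 1 z ^ 5) ∂μ)) := by
    refine tendsto_integral_filter_of_dominated_convergence
      (fun z => M * (3 / softNorm 1 z ^ 5)) (Eventually.of_forall fun ε => ?_)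
      (Eventually.of_forall fun ε => Eventually.of_forall fun z => ?_) (hint.const_mul M)
      (Eventually.of_forall fun z => Tendsto.mul_const _ ?_)
    · have : Continuous fun z : E => ψ (ε • z) := by fun_prop
      exact this.aestronglyMeasurable.mul hint.1
    · rw [norm_mul, Real.norm_of_nonneg (hpos z)]
      exact mul_le_mul_of_nonneg_right (hM _) (hpos z)
    · have : Continuous fun ε : ℝ => ψ (ε • z) := by fun_prop
      simpa using (this.tendsto 0).mono_left nhdsWithin_le_nhds
  rw [integral_const_mul] at hlim
  refine hlim.congr' ?_
  filter_upwards [self_mem_nhdsWithin] with ε hε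
  exact (integral_mul_inv_softNorm_pow_five_eq hE hε ψ).symm

theorem tendsto_integral_mul_fderiv_newtonKernel (hE : Module.finrank ℝ E = 3)
    (hψ : Continuous ψ) (hs : HasCompactSupport ψ) (w : E) :
    Tendsto (fun ε : ℝ => ∫ x, ψ x * fderiv ℝ (newtonKernel ε) x w ∂μ) (𝓝[>] 0)
      (𝓝 (∫ x, ψ x * fderiv ℝ (newtonKernel 0) x w ∂μ)) := by
  have := nontrivial_of_lt_finrank (E := E) (k := 2) (by rw [hE]; norm_num)
  have hne : ∀ᵐ x ∂μ, x ≠ 0 := Measure.ae_ne μ 0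
  have hbound : Integrable (fun x => |ψ x| * (‖x‖ ^ 2)⁻¹ * ‖w‖) μ :=
    (LocallyIntegrable.integrable_smul_left_of_hasCompactSupport
      (locallyIntegrable_inv_norm_pow (by rw [hE]; norm_num)) hψ.abs hs.norm).mul_const _
  refine tendsto_integral_filter_of_dominated_convergence _ ?_ ?_ hbound ?_
  · filter_upwards [self_mem_nhdsWithin] with ε hε
    have hsoft (x : E) : 0 < softNorm ε x := softNorm_pos (.inl (ne_of_gt hε))
    have hC1 : ContDiff ℝ ∞ (newtonKernel ε : E → ℝ) :=
      contDiff_iff_contDiffAt.2 fun x => contDiffAt_newtonKernel (hsoft x)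
    exact (hψ.mul ((hC1.continuous_fderiv (by simp)).clm_apply
      continuous_const)).aestronglyMeasurable
  · refine Eventually.of_forall fun ε => hne.mono fun x hx => ?_
    rw [norm_mul, mul_assoc]
    exact mul_le_mul_of_nonneg_left (abs_fderiv_newtonKernel_apply_le hx w) (norm_nonneg _)
  · refine hne.mono fun x hx => Tendsto.const_mul _ ?_
    have hsoft (ε : ℝ) : 0 < softNorm ε x := softNorm_pos (.inr hx)
    simp only [fderiv_newtonKernel_apply (hsoft _)]
    have hcont : Continuous fun ε => -(inner ℝ x w / softNorm ε x ^ 3) :=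
      (continuous_const.div ((continuous_softNorm_left x).pow 3)
        fun ε => pow_ne_zero 3 (hsoft ε).ne').neg
    exact (hcont.tendsto 0).mono_left nhdsWithin_le_nhds

theorem integral_laplacian_mul_fderiv_newtonKernel_zero (hE : Module.finrank ℝ E = 3)
    (hφ : ContDiff ℝ 3 φ) (hs : HasCompactSupport φ) (w : E) :
    ∫ x, Δ φ x * fderiv ℝ (newtonKernel 0) x w ∂μ = fderiv ℝ φ 0 w * newtonConstant μ := by
  have hΔφ : ContDiff ℝ 1 (Δ φ) := contDiff_laplacian (hφ.of_le (by norm_num))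
  refine tendsto_nhds_unique (tendsto_integral_mul_fderiv_newtonKernel hE hΔφ.continuous
    (hasCompactSupport_laplacian hs) w) ((tendsto_integral_mul_inv_softNorm_pow_five hE
      ((hφ.continuous_fderiv (by simp)).clm_apply continuous_const)
      (hs.fderiv_apply ℝ w)).congr' ?_)
  filter_upwards [self_mem_nhdsWithin] with ε hε
  have hsoft (x : E) : 0 < softNorm ε x := softNorm_pos (.inl (ne_of_gt hε))
  have hN : ContDiff ℝ 2 (newtonKernel ε : E → ℝ) := contDiff_iff_contDiffAt.2 fun x =>
    (contDiffAt_newtonKernel (hsoft x)).of_le (by norm_cast)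
  rw [integral_laplacian_mul_fderiv_eq_neg hφ hs hN, ← integral_neg]
  simp only [laplacian_newtonKernel hE (hsoft _), mul_neg, neg_neg]

theorem integral_laplacian_mul_fderiv_newtonKernel (hE : Module.finrank ℝ E = 3)
    (hφ : ContDiff ℝ 3 φ) (hs : HasCompactSupport φ) (y w : E) :
    ∫ x, Δ φ x * fderiv ℝ (newtonKernel 0) (x - y) w ∂μ = fderiv ℝ φ y w * newtonConstant μ := by
  have hshift := integral_laplacian_mul_fderiv_newtonKernel_zero (μ := μ) hE
    (φ := fun x => φ (x + y)) (by fun_prop) (hs.comp_homeomorph (Homeomorph.addRight y)) w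
  rw [fderiv_comp_add_right, zero_add] at hshift
  rw [← hshift, ← integral_add_right_eq_self _ y]
  simp only [laplacian_comp_add_right, add_sub_cancel_right]

end FundamentalSolution

section Cutoff

variable {E : Type*} [NormedAddCommGroup E] [NormedSpace ℝ E]

theorem exists_norm_fderiv_le_of_hasCompactSupport {φ : E → ℝ} (hφ : ContDiff ℝ 1 φ)
    (hs : HasCompactSupport φ) : ∃ C, ∀ y, ‖fderiv ℝ φ y‖ ≤ C :=
  (hφ.continuous_fderiv (by simp)).bounded_above_of_compact_support (hs.fderiv ℝ)

variable [FiniteDimensional ℝ E]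

theorem fderiv_bump_inv_smul_mul (χ : ContDiffBump (0 : E)) {φ : E → ℝ} {y : E}
    (hφ : DifferentiableAt ℝ φ y) (R : ℝ) :
    fderiv ℝ (fun y => χ (R⁻¹ • y) * φ y) y =
      χ (R⁻¹ • y) • fderiv ℝ φ y + φ y • R⁻¹ • fderiv ℝ χ (R⁻¹ • y) := by
  have hχ : DifferentiableAt ℝ (fun y => χ (R⁻¹ • y)) y :=
    (χ.contDiff.comp (contDiff_const_smul R⁻¹)).differentiable one_ne_zero y
  rw [fderiv_fun_mul hχ hφ, fderiv_comp_smul]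

theorem norm_le_of_fderiv_bump_ne_zero (χ : ContDiffBump (0 : E)) {R : ℝ} (hR : 0 < R) {y : E}
    (hy : fderiv ℝ χ (R⁻¹ • y) ≠ 0) : ‖y‖ ≤ R * χ.rOut := by
  have hmem := tsupport_fderiv_subset ℝ (subset_tsupport _ (Function.mem_support.2 hy))
  rwa [χ.tsupport_eq, mem_closedBall_zero_iff, norm_smul, norm_inv, Real.norm_of_nonneg hR.le,
    inv_mul_le_iff₀ hR] at hmem

-- The cutoff at scale `R` costs a factor `1 / R` in the derivative, and `φ` grows at most linearly
-- on the support of the cutoff.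
theorem exists_norm_fderiv_bump_inv_smul_mul_le (χ : ContDiffBump (0 : E)) {φ : E → ℝ} {C : ℝ}
    (hφ : Differentiable ℝ φ) (hφ₀ : φ 0 = 0) (hC : ∀ y, ‖fderiv ℝ φ y‖ ≤ C) :
    ∃ C', ∀ R : ℝ, 0 < R → ∀ y, ‖fderiv ℝ (fun y => χ (R⁻¹ • y) * φ y) y‖ ≤ C' := by
  obtain ⟨M, hM⟩ := exists_norm_fderiv_le_of_hasCompactSupport χ.contDiff χ.hasCompactSupport
  have hC₀ : 0 ≤ C := (norm_nonneg _).trans (hC 0)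
  have hlin (y : E) : |φ y| ≤ C * ‖y‖ := by
    simpa [hφ₀] using convex_univ.norm_image_sub_le_of_norm_fderiv_le
      (fun y _ => hφ y) (fun y _ => hC y) (mem_univ (0 : E)) (mem_univ y)
  have hr := χ.rOut_pos
  have hM₀ : 0 ≤ M := (norm_nonneg _).trans (hM 0)
  refine ⟨C + C * χ.rOut * M, fun R hR y => ?_⟩
  rw [fderiv_bump_inv_smul_mul χ (hφ y)]
  refine (norm_add_le _ _).trans (add_le_add ?_ ?_)
  · rw [norm_smul, Real.norm_of_nonneg χ.nonneg]
    exact (mul_le_of_le_one_left (norm_nonneg _) χ.le_one).trans (hC y)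
  · by_cases hy : fderiv ℝ χ (R⁻¹ • y) = 0
    · rw [hy, smul_zero, smul_zero, norm_zero]
      positivity
    · calc ‖φ y • R⁻¹ • fderiv ℝ χ (R⁻¹ • y)‖
          = |φ y| * (R⁻¹ * ‖fderiv ℝ χ (R⁻¹ • y)‖) := by
            rw [norm_smul, norm_smul, Real.norm_eq_abs, norm_inv, Real.norm_of_nonneg hR.le]
        _ ≤ C * (R * χ.rOut) * (R⁻¹ * M) := by
            gcongr
            · exact (hlin y).trans (by gcongr; exact norm_le_of_fderiv_bump_ne_zero χ hR hy)
            · exact hM _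
        _ = C * χ.rOut * M := by field_simp

theorem eventually_fderiv_bump_inv_smul_mul_eq (χ : ContDiffBump (0 : E)) (φ : E → ℝ) (y : E) :
    ∀ᶠ R : ℝ in atTop, fderiv ℝ (fun y => χ (R⁻¹ • y) * φ y) y = fderiv ℝ φ y := by
  have hlim : Tendsto (fun R : ℝ => R⁻¹ • y) atTop (𝓝 (0 : E)) := by
    simpa using (tendsto_inv_atTop_zero (𝕜 := ℝ)).smul_const y
  filter_upwards [hlim.eventually (ball_mem_nhds 0 χ.rIn_pos)] with R hR
  refine EventuallyEq.fderiv_eq ?_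
  have hcont : Continuous fun z : E => R⁻¹ • z := by fun_prop
  filter_upwards [hcont.continuousAt.preimage_mem_nhds (isOpen_ball.mem_nhds hR)] with z hz
  rw [χ.one_of_mem_closedBall (ball_subset_closedBall hz), one_mul]

theorem exists_contDiff_fderiv_eq_of_isHomogeneousKernel {k : ℕ} {K : E → ℝ}
    (hK : IsHomogeneousKernel k K) {δ : ℝ} (hδ : 0 < δ) :
    ∃ ψ : E → ℝ, ContDiff ℝ ∞ ψ ∧ (∃ C, ∀ z, ‖fderiv ℝ ψ z‖ ≤ C) ∧
      ∀ z, δ ≤ ‖z‖ → fderiv ℝ ψ z = fderiv ℝ K z := by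
  let χ : ContDiffBump (0 : E) := ⟨δ / 4, δ / 2, by positivity, by linarith⟩
  let ψ : E → ℝ := fun z => (1 - χ z) * K z
  have hnear : ψ =ᶠ[𝓝 0] fun _ => 0 := χ.eventuallyEq_one.mono fun z hz => by simp [ψ, hz]
  have hfar (z : E) (hz : δ ≤ ‖z‖) : fderiv ℝ ψ z = fderiv ℝ K z := by
    refine EventuallyEq.fderiv_eq ?_
    filter_upwards [continuous_norm.continuousAt.eventually_const_lt
      ((half_lt_self hδ).trans_le hz)] with y hy
    simp [ψ, χ.zero_of_le_dist (x := y) (by simpa using hy.le)]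
  have hψ : ContDiff ℝ ∞ ψ := contDiff_iff_contDiffAt.2 fun z => by
    rcases eq_or_ne z 0 with rfl | hz
    · exact contDiffAt_const.congr_of_eventuallyEq hnear
    · exact (contDiffAt_const.sub χ.contDiffAt).mul (hK.contDiffAt hz)
  obtain ⟨M, hM⟩ := (isCompact_closedBall (0 : E) δ).exists_bound_of_continuousOn
    (hψ.continuous_fderiv (by simp)).continuousOn
  obtain ⟨C, hC, hKC⟩ := hK.fderiv.exists_norm_le
  refine ⟨ψ, hψ, ⟨max M (C / δ ^ (k + 1)), fun z => ?_⟩, hfar⟩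
  rcases le_total ‖z‖ δ with hz | hz
  · exact (hM z (mem_closedBall_zero_iff.2 hz)).trans (le_max_left _ _)
  · rw [hfar z hz]
    refine (hKC z (norm_pos_iff.1 (hδ.trans_le hz))).trans (le_max_of_le_right ?_)
    gcongr

end Cutoff

section DivergenceFree

variable {E : Type*} [NormedAddCommGroup E] [NormedSpace ℝ E] [MeasurableSpace E]
  {m : Measure E} {f : E → E}

/-- The vector measure `f • m` is divergence-free in the sense of distributions: it annihilates the
gradients of all test functions. -/
def IsDivFree (m : Measure E) (f : E → E) : Prop :=
  ∀ φ : E → ℝ, ContDiff ℝ ∞ φ → HasCompactSupport φ → ∫ y, fderiv ℝ φ y (f y) ∂m = 0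

variable [FiniteDimensional ℝ E] [BorelSpace E]

theorem IsDivFree.restrict (hd : IsDivFree m f) {A B : Set E} (hA : IsClosed A) (hB : IsClosed B)
    (hAB : Disjoint A B) (hm : m (A ∪ B)ᶜ = 0) : IsDivFree (m.restrict A) f := by
  intro φ hφ hs
  obtain ⟨χ, hχB, hχA, hχ⟩ :=
    exists_contMDiffMap_zero_one_of_isClosed (n := ⊤) 𝓘(ℝ, E) hB hA hAB.symm
  have hχs : ContDiff ℝ ∞ χ := χ.contMDiff.contDiff
  have hdA : ∀ y ∈ A, fderiv ℝ χ y = 0 := fun y hy =>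
    IsLocalMax.fderiv_eq_zero (Eventually.of_forall fun z => (hχ z).2.trans_eq (hχA hy).symm)
  have hdB : ∀ y ∈ B, fderiv ℝ χ y = 0 := fun y hy =>
    IsLocalMin.fderiv_eq_zero (Eventually.of_forall fun z => (hχB hy).trans_le (hχ z).1)
  have hmul (y : E) :
      fderiv ℝ (fun y => χ y * φ y) y = χ y • fderiv ℝ φ y + φ y • fderiv ℝ χ y :=
    fderiv_fun_mul (hχs.differentiable (by simp) y) (hφ.differentiable (by simp) y)
  have hAB_ae : ∀ᵐ y ∂m, y ∈ A ∪ B := mem_ae_iff.2 hm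
  rw [← hd (fun y => χ y * φ y) (hχs.mul hφ) hs.mul_left, ← integral_indicator hA.measurableSet]
  refine integral_congr_ae (hAB_ae.mono fun y hy => ?_)
  by_cases hyA : y ∈ A
  · simp [hmul, hyA, hdA y hyA, hχA hyA]
  · have hyB := hy.resolve_left hyA
    simp [hmul, hyA, hdB y hyB, hχB hyB]

theorem aestronglyMeasurable_fderiv_apply {φ : E → ℝ} (hφ : ContDiff ℝ 1 φ)
    (hf : AEStronglyMeasurable f m) : AEStronglyMeasurable (fun y => fderiv ℝ φ y (f y)) m :=
  (ContinuousLinearMap.id ℝ (E →L[ℝ] ℝ)).aestronglyMeasurable_comp₂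
    (hφ.continuous_fderiv (by simp)).aestronglyMeasurable hf

namespace IsDivFree

theorem integral_fderiv_apply_eq_zero_of_map_zero (hd : IsDivFree m f) (hf : Integrable f m)
    {φ : E → ℝ} (hφ : ContDiff ℝ ∞ φ) (hφ₀ : φ 0 = 0) {C : ℝ} (hC : ∀ y, ‖fderiv ℝ φ y‖ ≤ C) :
    ∫ y, fderiv ℝ φ y (f y) ∂m = 0 := by
  let χ : ContDiffBump (0 : E) := ⟨1, 2, one_pos, one_lt_two⟩
  obtain ⟨C', hC'⟩ := exists_norm_fderiv_bump_inv_smul_mul_le χ (hφ.differentiable (by simp)) hφ₀ hC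
  have hcutoff (R : ℝ) : ContDiff ℝ ∞ fun y => χ (R⁻¹ • y) * φ y :=
    (χ.contDiff.comp (contDiff_const_smul _)).mul hφ
  have hlim : Tendsto (fun R : ℝ => ∫ y, fderiv ℝ (fun y => χ (R⁻¹ • y) * φ y) y (f y) ∂m) atTop
      (𝓝 (∫ y, fderiv ℝ φ y (f y) ∂m)) := by
    refine tendsto_integral_filter_of_dominated_convergence (fun y => C' * ‖f y‖)
      (Eventually.of_forall fun R =>
        aestronglyMeasurable_fderiv_apply ((hcutoff R).of_le (by simp)) hf.1)
      ?_ (hf.norm.const_mul _) (Eventually.of_forall fun y => tendsto_const_nhds.congr' ?_)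
    · filter_upwards [eventually_gt_atTop 0] with R hR
      exact Eventually.of_forall fun y => ContinuousLinearMap.le_of_opNorm_le _ (hC' R hR y) _
    · filter_upwards [eventually_fderiv_bump_inv_smul_mul_eq χ φ y] with R hR
      rw [hR]
  refine tendsto_nhds_unique hlim (tendsto_const_nhds.congr' ?_)
  filter_upwards [eventually_ne_atTop 0] with R hR
  have hcompact : HasCompactSupport fun y => χ (R⁻¹ • y) :=
    χ.hasCompactSupport.comp_smul (inv_ne_zero hR)
  exact (hd _ (hcutoff R) hcompact.mul_right).symm

theorem integral_fderiv_apply_eq_zero (hd : IsDivFree m f) (hf : Integrable f m)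
    {φ : E → ℝ} (hφ : ContDiff ℝ ∞ φ) {C : ℝ} (hC : ∀ y, ‖fderiv ℝ φ y‖ ≤ C) :
    ∫ y, fderiv ℝ φ y (f y) ∂m = 0 := by
  have hshift (y : E) : fderiv ℝ (fun y => φ y - φ 0) y = fderiv ℝ φ y := fderiv_sub_const _
  simpa only [hshift] using hd.integral_fderiv_apply_eq_zero_of_map_zero hf
    (hφ.sub contDiff_const) (sub_self (φ 0)) (fun y => (hshift y).symm ▸ hC y)

theorem integral_eq_zero (hd : IsDivFree m f) (hf : Integrable f m) : ∫ y, f y ∂m = 0 := by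
  refine SeparatingDual.eq_zero_of_forall_dual_eq_zero (R := ℝ) fun L => ?_
  rw [← L.integral_comp_comm hf]
  simpa using hd.integral_fderiv_apply_eq_zero hf L.contDiff (C := ‖L‖) (fun y => by simp)

end IsDivFree

theorem IsDivFree.kernelIntegral_fderiv_eq_zero {k : ℕ} {K : E → ℝ} (hd : IsDivFree m f)
    (hK : IsHomogeneousKernel k K) (hf : Integrable f m) {T : Set E} (hT : IsClosed T)
    (hm : m Tᶜ = 0) {x : E} (hx : x ∉ T) : kernelIntegral (fderiv ℝ K) m f x = 0 := by
  obtain ⟨δ, hδ, hdist⟩ := exists_pos_le_norm_sub_of_mem_ball hT hx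
  obtain ⟨ψ, hψ, ⟨C, hC⟩, hψK⟩ := exists_contDiff_fderiv_eq_of_isHomogeneousKernel hK hδ
  have hrefl (y : E) : fderiv ℝ (fun y => ψ (x - y)) y = -fderiv ℝ ψ (x - y) := by
    have hcomp := (hψ.differentiable (by simp) (x - y)).hasFDerivAt.comp y
      ((hasFDerivAt_id y).const_sub x)
    exact hcomp.fderiv.trans (by ext; simp)
  have hzero := hd.integral_fderiv_apply_eq_zero hf (φ := fun y => ψ (x - y)) (by fun_prop)
    (fun y => by rw [hrefl, norm_neg]; exact hC _)
  have hT_ae : ∀ᵐ y ∂m, y ∈ T := mem_ae_iff.2 hm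
  rw [kernelIntegral, ← neg_eq_zero, ← integral_neg, ← hzero]
  refine integral_congr_ae (hT_ae.mono fun y hy => ?_)
  simp only [hrefl, neg_apply, hψK _ (hdist x (mem_ball_self hδ) y hy)]

theorem IsDivFree.kernelIntegral_flipDeriv_fderiv_eq_zero {k : ℕ} {K : E → ℝ} (hd : IsDivFree m f)
    (hK : IsHomogeneousKernel k K) (hf : Integrable f m) {T : Set E} (hT : IsClosed T)
    (hm : m Tᶜ = 0) {x : E} (hx : x ∉ T) : kernelIntegral (flipDeriv (fderiv ℝ K)) m f x = 0 := by
  have hconst : kernelIntegral (fderiv ℝ K) m f =ᶠ[𝓝 x] fun _ => 0 :=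
    (hT.isOpen_compl.eventually_mem hx).mono fun x' hx' =>
      hd.kernelIntegral_fderiv_eq_zero hK hf hT hm hx'
  exact (hasFDerivAt_kernelIntegral hK.fderiv hf hT hm hx).unique
    ((hasFDerivAt_const 0 x).congr_of_eventuallyEq hconst)

end DivergenceFree

section SlenderDomain

theorem kernelIntegral_eq_zero_of_flipDeriv_eq_zero {E F G : Type*} [NormedAddCommGroup E]
    [NormedSpace ℝ E] [FiniteDimensional ℝ E] [MeasurableSpace E] [BorelSpace E] {μ : Measure E}
    [μ.IsAddHaarMeasure] [NormedAddCommGroup F] [NormedSpace ℝ F] [NormedAddCommGroup G]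
    [NormedSpace ℝ G] {k : ℕ} {K : E → F →L[ℝ] G} {m : Measure E} [SFinite m] {f : E → F}
    {T : Set E} {x : E} (hk₀ : k ≠ 0) (hk : k < Module.finrank ℝ E)
    (hK : IsHomogeneousKernel k K) (hf : Integrable f m) (hT : IsClosed T) (hm : m Tᶜ = 0)
    (hzero : ∀ x ∉ T, kernelIntegral (flipDeriv K) m f x = 0) (hx : x ∉ T)
    (hinf : μ (connectedComponentIn Tᶜ x) = ⊤) : kernelIntegral K m f x = 0 := by
  have hopen : IsOpen (connectedComponentIn Tᶜ x) := hT.isOpen_compl.connectedComponentIn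
  have hderiv : ∀ y ∈ connectedComponentIn Tᶜ x, HasFDerivAt (kernelIntegral K m f) 0 y :=
    fun y hy => by
      have hyT := connectedComponentIn_subset _ _ hy
      simpa only [hzero y hyT] using hasFDerivAt_kernelIntegral hK hf hT hm hyT
  refine eq_zero_of_kernelIntegral_eq_const hk₀ hk hK hf hopen.measurableSet hinf fun y hy => ?_
  exact hopen.is_const_of_fderiv_eq_zero (𝕜 := ℝ) isPreconnected_connectedComponentIn
    (fun z hz => (hderiv z hz).differentiableAt.differentiableWithinAt)
    (fun z hz => (hderiv z hz).fderiv) hy (mem_connectedComponentIn hx)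

variable {E : Type*} [NormedAddCommGroup E] [InnerProductSpace ℝ E] [FiniteDimensional ℝ E]
  [MeasurableSpace E] [BorelSpace E] {μ : Measure E} [μ.IsAddHaarMeasure]
  {m : Measure E} [SFinite m] {f : E → E}

theorem integrable_laplacian_mul_fderiv_newtonKernel_prod (hE : Module.finrank ℝ E = 3)
    (hf : Integrable f m) {φ : E → ℝ} (hφ : ContDiff ℝ 2 φ) (hs : HasCompactSupport φ) :
    Integrable (fun p : E × E => Δ φ p.1 * fderiv ℝ (newtonKernel 0) (p.1 - p.2) (f p.2))
      ((μ.restrict (tsupport (Δ φ))).prod m) := by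
  have hΔ : Continuous (Δ φ) := (contDiff_laplacian (n := 0) hφ).continuous
  have hΔs := hasCompactSupport_laplacian hs
  obtain ⟨C, hC⟩ := hΔ.bounded_above_of_compact_support hΔs
  exact (integrable_kernel_prod two_ne_zero (by lia) isHomogeneousKernel_fderiv_newtonKernel hf
    hΔs.isCompact.measure_ne_top).bdd_mul (hΔ.comp continuous_fst).aestronglyMeasurable
    (Eventually.of_forall fun p => hC p.1)

-- Testing against `φ = N ∗ Δφ`, up to a constant, moves the divergence of `f • m` onto its
-- potential.
theorem isDivFree_of_kernelIntegral_eq_zero (hE : Module.finrank ℝ E = 3) (hf : Integrable f m)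
    (hzero : ∀ᵐ x ∂μ, kernelIntegral (fderiv ℝ (newtonKernel 0)) m f x = 0) : IsDivFree m f := by
  intro φ hφ hs
  have hφ₃ : ContDiff ℝ 3 φ := mod_cast contDiff_infty.1 hφ 3
  have hprod := integrable_laplacian_mul_fderiv_newtonKernel_prod (μ := μ) hE hf
    (hφ₃.of_le (by norm_num)) hs
  have hfubini : (∫ y, fderiv ℝ φ y (f y) ∂m) * newtonConstant μ = 0 := calc
    (∫ y, fderiv ℝ φ y (f y) ∂m) * newtonConstant μ
      = ∫ y, ∫ x, Δ φ x * fderiv ℝ (newtonKernel 0) (x - y) (f y) ∂μ ∂m := by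
      rw [← integral_mul_const]
      refine integral_congr_ae (Eventually.of_forall fun y => ?_)
      exact (integral_laplacian_mul_fderiv_newtonKernel hE hφ₃ hs y (f y)).symm
    _ = ∫ y, ∫ x in tsupport (Δ φ), Δ φ x * fderiv ℝ (newtonKernel 0) (x - y) (f y) ∂μ ∂m := by
      refine integral_congr_ae (Eventually.of_forall fun y => ?_)
      exact (setIntegral_eq_integral_of_forall_compl_eq_zero fun x hx => by
        rw [image_eq_zero_of_notMem_tsupport hx, zero_mul]).symm
    _ = ∫ x in tsupport (Δ φ), Δ φ x * kernelIntegral (fderiv ℝ (newtonKernel 0)) m f x ∂μ := by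
      rw [← integral_integral_swap hprod]
      simp only [integral_const_mul, kernelIntegral]
    _ = 0 := integral_eq_zero_of_ae ((ae_restrict_of_ae hzero).mono fun x hx => by simp [hx])
  exact (mul_eq_zero.1 hfubini).resolve_right (newtonConstant_pos hE).ne'

theorem isDivFree_of_flipDeriv_eq_zero (hE : Module.finrank ℝ E = 3) (hf : Integrable f m)
    {T : Set E} (hT : IsClosed T) (hm : m Tᶜ = 0) (hT₀ : μ T = 0)
    (hinf : ∀ x ∈ Tᶜ, μ (connectedComponentIn Tᶜ x) = ⊤)
    (hzero : ∀ x ∉ T, kernelIntegral (flipDeriv (fderiv ℝ (newtonKernel 0))) m f x = 0) :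
    IsDivFree m f :=
  isDivFree_of_kernelIntegral_eq_zero (μ := μ) hE hf <|
    (measure_eq_zero_iff_ae_notMem.1 hT₀).mono fun x hx =>
      kernelIntegral_eq_zero_of_flipDeriv_eq_zero two_ne_zero (by lia)
        isHomogeneousKernel_fderiv_newtonKernel hf hT hm hzero hx (hinf x hx)

end SlenderDomain

section Translation

theorem norm_mul_le_of_bounded {α : Type*} {φ s : α → ℝ} {C : ℝ} (hC : ∀ y, ‖φ y‖ ≤ C) (y z : α) :
    ‖φ y * s z‖ ≤ C * ‖s z‖ := by
  rw [norm_mul]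
  gcongr
  exact hC y

variable {E : Type*} [NormedAddCommGroup E] [NormedSpace ℝ E] [MeasurableSpace E]
  [BorelSpace E] {m : Measure E} {s : E → ℝ} {φ : E → ℝ}

theorem hasDerivAt_integral_comp_add_smul_mul (hs : Integrable s m) (hφ : ContDiff ℝ 1 φ)
    (hφs : HasCompactSupport φ) (v : E) (t : ℝ) :
    HasDerivAt (fun t : ℝ => ∫ y, φ (y + t • v) * s y ∂m)
      (∫ y, fderiv ℝ φ (y + t • v) v * s y ∂m) t := by
  obtain ⟨C, hC⟩ := hφ.continuous.bounded_above_of_compact_support hφs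
  have hφ' : Continuous fun y => fderiv ℝ φ y v :=
    (hφ.continuous_fderiv one_ne_zero).clm_apply continuous_const
  obtain ⟨C', hC'⟩ := hφ'.bounded_above_of_compact_support (hφs.fderiv_apply ℝ v)
  have hmeas (t : ℝ) {ψ : E → ℝ} (hψ : Continuous ψ) :
      AEStronglyMeasurable (fun y => ψ (y + t • v) * s y) m :=
    (hψ.comp (continuous_id.add continuous_const)).aestronglyMeasurable.mul hs.1
  refine (hasDerivAt_integral_of_dominated_loc_of_deriv_le univ_mem
    (F := fun t y => φ (y + t • v) * s y) (F' := fun t y => fderiv ℝ φ (y + t • v) v * s y)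
    (bound := fun y => C' * ‖s y‖) (Eventually.of_forall fun t => hmeas t hφ.continuous)
    ((hs.norm.const_mul C).mono' (hmeas t hφ.continuous)
      (Eventually.of_forall fun y => norm_mul_le_of_bounded hC _ _)) (hmeas t hφ')
    (Eventually.of_forall fun y t _ => norm_mul_le_of_bounded hC' _ _) (hs.norm.const_mul C')
    (Eventually.of_forall fun y t _ => HasDerivAt.mul_const ?_ _)).2
  have hline : HasDerivAt (fun t : ℝ => y + t • v) v t := by
    simpa using ((hasDerivAt_id t).smul_const v).const_add y
  exact (hφ.differentiable one_ne_zero _).hasFDerivAt.comp_hasDerivAt t hline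

theorem tendsto_integral_comp_add_smul_mul (hs : Integrable s m) (hφ : Continuous φ)
    (hφs : HasCompactSupport φ) {v : E} (hv : v ≠ 0) :
    Tendsto (fun t : ℝ => ∫ y, φ (y + t • v) * s y ∂m) atTop (𝓝 0) := by
  obtain ⟨C, hC⟩ := hφ.bounded_above_of_compact_support hφs
  rw [← integral_zero E ℝ (μ := m)]
  refine tendsto_integral_filter_of_dominated_convergence (fun y => C * ‖s y‖)
    (Eventually.of_forall fun t =>
      (hφ.comp (continuous_id.add continuous_const)).aestronglyMeasurable.mul hs.1)
    (Eventually.of_forall fun t => Eventually.of_forall fun y => norm_mul_le_of_bounded hC _ _)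
    (hs.norm.const_mul C) (Eventually.of_forall fun y => tendsto_const_nhds.congr' ?_)
  obtain ⟨r, hr⟩ := hφs.isCompact.isBounded.exists_norm_le
  have hnorm : Tendsto (fun t : ℝ => t * ‖v‖) atTop atTop :=
    tendsto_id.atTop_mul_const (norm_pos_iff.2 hv)
  filter_upwards [hnorm.eventually_gt_atTop (r + ‖y‖), eventually_ge_atTop 0] with t ht ht₀
  suffices hmem : y + t • v ∉ tsupport φ by rw [image_eq_zero_of_notMem_tsupport hmem, zero_mul]
  intro hmem
  have htri := norm_sub_norm_le (t • v) (-y)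
  rw [norm_smul, Real.norm_of_nonneg ht₀, norm_neg, sub_neg_eq_add, add_comm (t • v)] at htri
  linarith [hr _ hmem]

-- A divergence-free measure `s v • m` is invariant under translations along `v`, and a finite
-- measure with this property vanishes.
theorem IsDivFree.ae_eq_zero_of_smul_const [FiniteDimensional ℝ E] [IsLocallyFiniteMeasure m]
    {v : E} (hd : IsDivFree m fun y => s y • v) (hs : Integrable s m) (hv : v ≠ 0) :
    s =ᵐ[m] 0 := by
  refine ae_eq_zero_of_integral_contDiff_smul_eq_zero hs.locallyIntegrable fun φ hφ hφs => ?_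
  have hderiv (t : ℝ) : HasDerivAt (fun t : ℝ => ∫ y, φ (y + t • v) * s y ∂m) 0 t := by
    have hzero := hd (fun y => φ (y + t • v)) (by fun_prop)
      (hφs.comp_homeomorph (Homeomorph.addRight (t • v)))
    simp only [fderiv_comp_add_right, map_smul, smul_eq_mul, mul_comm (s _)] at hzero
    exact hzero ▸ hasDerivAt_integral_comp_add_smul_mul hs (hφ.of_le (by simp)) hφs v t
  have hconst (t : ℝ) : ∫ y, φ (y + t • v) * s y ∂m = ∫ y, φ y * s y ∂m := by
    simpa using is_const_of_deriv_eq_zero (fun t => (hderiv t).differentiableAt)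
      (fun t => (hderiv t).deriv) t 0
  exact tendsto_nhds_unique tendsto_const_nhds
    ((tendsto_integral_comp_add_smul_mul hs hφ.continuous hφs hv).congr hconst)

end Translation

section DipoleKernel

variable {E : Type*} [NormedAddCommGroup E] [InnerProductSpace ℝ E] {z : E}

/-- The kernel pairing a displacement `z`, a dipole moment `w` and a direction `v` to
`3 ⟪z, v⟫ ⟪z, w⟫ / ‖z‖⁵ - ⟪v, w⟫ / ‖z‖³`: up to a constant, the `v`-component of the field of the
dipole `w`. It is the second derivative of the Newton kernel. -/
def dipoleKernel : E → E →L[ℝ] E →L[ℝ] ℝ := flipDeriv (fderiv ℝ (newtonKernel 0))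

theorem dipoleKernel_apply (hz : z ≠ 0) (w v : E) :
    dipoleKernel z w v =
      3 * (inner ℝ z v * inner ℝ z w) / ‖z‖ ^ 5 - inner ℝ v w / ‖z‖ ^ 3 := by
  rw [dipoleKernel, flipDeriv_apply, fderiv_fderiv_newtonKernel_apply (softNorm_pos (.inr hz)),
    softNorm_zero]

theorem dipoleKernel_apply_eq_neg_inner (hz : z ≠ 0) (w v : E) :
    dipoleKernel z w v =
      -inner ℝ v ((1 / ‖z‖ ^ 3) • w - (3 : ℝ) • ((1 / ‖z‖ ^ 5) • rankOne ℝ z z) w) := by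
  rw [dipoleKernel_apply hz, smul_apply, rankOne_apply, inner_sub_right]
  simp only [inner_smul_right]
  rw [real_inner_comm z v]
  ring

theorem isHomogeneousKernel_dipoleKernel : IsHomogeneousKernel 3 (dipoleKernel (E := E)) :=
  isHomogeneousKernel_fderiv_newtonKernel.flipDeriv

theorem harmonicOnNhd_dipoleKernel [FiniteDimensional ℝ E] (hE : Module.finrank ℝ E = 3) :
    HarmonicOnNhd (dipoleKernel (E := E)) {0}ᶜ := fun z hz =>
  have hN : ContDiffAt ℝ 4 (newtonKernel 0) z :=
    mod_cast contDiffAt_infty.1 (contDiffAt_newtonKernel (softNorm_pos (.inr hz))) 4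
  harmonicAt_flipDeriv (hN.fderiv_right (by norm_num))
    (harmonicAt_fderiv (hN.of_le (by norm_num)) (harmonicOnNhd_newtonKernel hE z hz))

theorem eq_zero_of_dipoleKernel_apply_eq_zero {w : E} (h : ∀ z ≠ 0, dipoleKernel z w = 0) :
    w = 0 := by
  by_contra hw
  have hself := congrArg (fun L : E →L[ℝ] ℝ => L w) (h w hw)
  simp only [dipoleKernel_apply hw, real_inner_self_eq_norm_sq, zero_apply] at hself
  have := norm_pos_iff.2 hw
  field_simp at hself
  norm_num at hself

end DipoleKernel

section VectorIntegral

variable {X E F G : Type*} [NormedAddCommGroup E] [NormedSpace ℝ E] [NormedAddCommGroup F]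
  [NormedSpace ℝ F] [NormedAddCommGroup G] [NormedSpace ℝ G]

theorem norm_apply_apply_le_of_norm_le_one (B : E →L[ℝ] F →L[ℝ] G) (a : E) {b : F}
    (hb : ‖b‖ ≤ 1) : ‖B a b‖ ≤ ‖B‖ * ‖a‖ :=
  (B.le_opNorm₂ _ _).trans (mul_le_of_le_one_right (by positivity) hb)

variable [MeasurableSpace X] {g : X → E} {u : X → F}

theorem integrable_pairing {m : Measure X} (B : E →L[ℝ] F →L[ℝ] G) (hg : Integrable g m)
    (hum : AEStronglyMeasurable u m) (hu : ∀ᵐ x ∂m, ‖u x‖ ≤ 1) :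
    Integrable (fun x => B (g x) (u x)) m :=
  (hg.norm.const_mul ‖B‖).mono' (B.aestronglyMeasurable_comp₂ hg.1 hum)
    (hu.mono fun _ => norm_apply_apply_le_of_norm_le_one B _)

theorem continuous_integral_pairing {m : Measure X} (B : E →L[ℝ] F →L[ℝ] G)
    (hum : AEStronglyMeasurable u m) (hu : ∀ᵐ x ∂m, ‖u x‖ ≤ 1) :
    Continuous fun g : Lp E 1 m => ∫ x, B (g x) (u x) ∂m := by
  refine LipschitzWith.continuous (K := ‖B‖₊) (LipschitzWith.of_dist_le_mul fun g h => ?_)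
  rw [dist_eq_norm, ← integral_sub (integrable_pairing B (L1.integrable_coeFn g) hum hu)
    (integrable_pairing B (L1.integrable_coeFn h) hum hu), dist_eq_norm, L1.norm_eq_integral_norm,
    coe_nnnorm, ← integral_const_mul]
  refine norm_integral_le_of_norm_le ((L1.integrable_coeFn (g - h)).norm.const_mul _) ?_
  filter_upwards [hu, Lp.coeFn_sub g h] with x hx hsub
  rw [← sub_apply, ← map_sub, hsub]
  exact norm_apply_apply_le_of_norm_le_one B _ hx

theorem vectorIntegral_eq_integral_of_withDensityᵥ_variation [CompleteSpace F] [CompleteSpace G]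
    {μ : VectorMeasure X F} (hum : Integrable u μ.variation) (hu : ∀ᵐ x ∂μ.variation, ‖u x‖ ≤ 1)
    (hμ : μ.variation.withDensityᵥ u = μ) (B : E →L[ℝ] F →L[ℝ] G)
    (hg : Integrable g μ.variation) :
    ∫ᵛ x, g x ∂[B; μ] = ∫ x, B (g x) (u x) ∂μ.variation := by
  refine hg.induction (P := fun g => ∫ᵛ x, g x ∂[B; μ] = ∫ x, B (g x) (u x) ∂μ.variation)
    (fun c s hs hfin => ?indicator) (fun g h _ hg hh ihg ihh => ?add) ?closed
    fun g h hgh _ ih => ?congr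
  case indicator =>
    have : IsFiniteMeasure (μ.variation.restrict s) := isFiniteMeasure_restrict.2 hfin.ne
    have hμs : μ s = ∫ x in s, u x ∂μ.variation := by
      rw [← withDensityᵥ_apply hum hs, hμ]
    rw [VectorMeasure.integral_indicator_const c hs, hμs,
      ← (B c).integral_comp_comm hum.integrableOn, ← integral_indicator hs]
    congr 1
    funext x
    by_cases hx : x ∈ s <;> simp [hx]
  case add =>
    simp only [Pi.add_apply, map_add, add_apply]
    rw [VectorMeasure.integral_fun_add hg hh, ihg, ihh,
      integral_add (integrable_pairing B hg hum.1 hu) (integrable_pairing B hh hum.1 hu)]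
  case closed =>
    exact isClosed_eq VectorMeasure.continuous_integral (continuous_integral_pairing B hum.1 hu)
  case congr =>
    rw [← VectorMeasure.integral_congr_ae hgh, ih]
    exact integral_congr_ae (hgh.mono fun x hx => by simp only [hx])

end VectorIntegral

section PolarDensity

variable {μ : Magnetization} {T B : Set R3}

theorem enorm_le_sum_enorm {ι : Type*} [Fintype ι] (w : EuclideanSpace ℝ ι) :
    ‖w‖ₑ ≤ ∑ j, ‖w j‖ₑ := by
  classical
  calc ‖w‖ₑ = ‖∑ j, EuclideanSpace.single j (w j)‖ₑ := by
        congr 1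
        ext i
        simp [Finset.sum_apply]
    _ ≤ ∑ j, ‖EuclideanSpace.single j (w j)‖ₑ := enorm_sum_le _ _
    _ = ∑ j, ‖w j‖ₑ := by simp [enorm_eq_nnnorm]

instance isFiniteMeasure_variation (μ : Magnetization) : IsFiniteMeasure μ.variation := by
  have hle : μ.variation ≤ ∑ j, (component μ j).totalVariation := by
    refine VectorMeasure.variation_le_of_forall_enorm_le fun B _ => ?_
    rw [Measure.finsetSum_apply]
    exact (enorm_le_sum_enorm _).trans
      (Finset.sum_le_sum fun j _ => (component μ j).enorm_le_totalVariation B)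
  exact isFiniteMeasure_of_le _ hle

theorem integrable_polarDensity (μ : Magnetization) :
    Integrable (polarDensity μ) μ.variation :=
  Integrable.of_eval_piLp fun j => (component μ j).integrable_rnDeriv μ.variation

theorem component_absolutelyContinuous_variation (μ : Magnetization) (j : Fin 3) :
    component μ j ≪ᵥ μ.variation.toENNRealVectorMeasure := by
  refine VectorMeasure.AbsolutelyContinuous.mk fun B hB hnull => ?_
  rw [Measure.toENNRealVectorMeasure_apply_measurable hB] at hnull
  have hle : ‖μ B‖ₑ ≤ 0 := hnull ▸ μ.enorm_measure_le_variation B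
  rw [component_apply, enorm_eq_zero.1 (nonpos_iff_eq_zero.1 hle), PiLp.zero_apply]

theorem withDensityᵥ_polarDensity (μ : Magnetization) :
    μ.variation.withDensityᵥ (polarDensity μ) = μ := by
  ext B hB j
  rw [withDensityᵥ_apply (integrable_polarDensity μ) hB, eval_integral_piLp
    (integrable_piLp_iff.1 (integrable_polarDensity μ).integrableOn)]
  change ∫ x in B, (component μ j).rnDeriv μ.variation x ∂μ.variation = component μ j B
  rw [← withDensityᵥ_apply ((component μ j).integrable_rnDeriv μ.variation) hB,
    (component μ j).withDensityᵥ_rnDeriv_eq μ.variation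
      (component_absolutelyContinuous_variation μ j)]

theorem apply_eq_setIntegral_polarDensity (μ : Magnetization) (hB : MeasurableSet B) :
    μ B = ∫ x in B, polarDensity μ x ∂μ.variation := by
  rw [← withDensityᵥ_apply (integrable_polarDensity μ) hB, withDensityᵥ_polarDensity]

theorem norm_polarDensity_ae_eq_one (μ : Magnetization) :
    ∀ᵐ x ∂μ.variation, ‖polarDensity μ x‖ = 1 := by
  have hvar := Measure.variation_withDensityᵥ (integrable_polarDensity μ)
  rw [withDensityᵥ_polarDensity] at hvar
  have hdensity : μ.variation.withDensity (fun x => ‖polarDensity μ x‖ₑ)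
      = μ.variation.withDensity 1 := by rw [← hvar, withDensity_one]
  have henorm := (withDensity_eq_iff_of_sigmaFinite
    (integrable_polarDensity μ).aestronglyMeasurable.enorm aemeasurable_const).1 hdensity
  filter_upwards [henorm] with x hx
  exact (toReal_enorm _).symm.trans (congrArg ENNReal.toReal hx)

theorem integrable_pairing_polarDensity {E G : Type*} [NormedAddCommGroup E] [NormedSpace ℝ E]
    [NormedAddCommGroup G] [NormedSpace ℝ G] {g : R3 → E} (b : E →L[ℝ] R3 →L[ℝ] G)
    (hg : Integrable g μ.variation) :
    Integrable (fun x => b (g x) (polarDensity μ x)) μ.variation :=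
  integrable_pairing b hg (integrable_polarDensity μ).1
    ((norm_polarDensity_ae_eq_one μ).mono fun _ h => h.le)

theorem vectorIntegral_eq_integral_polarDensity {E G : Type*} [NormedAddCommGroup E]
    [NormedSpace ℝ E] [NormedAddCommGroup G] [NormedSpace ℝ G] [CompleteSpace G] {g : R3 → E}
    (b : E →L[ℝ] R3 →L[ℝ] G) (hg : Integrable g μ.variation) :
    ∫ᵛ x, g x ∂[b; μ] = ∫ x, b (g x) (polarDensity μ x) ∂μ.variation :=
  vectorIntegral_eq_integral_of_withDensityᵥ_variation (integrable_polarDensity μ)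
    ((norm_polarDensity_ae_eq_one μ).mono fun _ h => h.le) (withDensityᵥ_polarDensity μ) b hg

theorem eq_zero_of_polarDensity_ae_eq_zero (h : polarDensity μ =ᵐ[μ.variation] 0) : μ = 0 := by
  rw [← withDensityᵥ_polarDensity μ, WithDensityᵥEq.congr_ae h, withDensityᵥ_zero]

theorem restrict_withDensityᵥ {X F : Type*} [MeasurableSpace X] [NormedAddCommGroup F]
    [NormedSpace ℝ F] {m : Measure X} {f : X → F} (hf : Integrable f m) {T : Set X}
    (hT : MeasurableSet T) : (m.withDensityᵥ f).restrict T = (m.restrict T).withDensityᵥ f := by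
  ext B hB : 1
  rw [VectorMeasure.restrict_apply _ hT hB, withDensityᵥ_apply hf (hB.inter hT),
    withDensityᵥ_apply hf.integrableOn hB, Measure.restrict_restrict hB]

theorem polarDensity_restrict (μ : Magnetization) (hT : MeasurableSet T) :
    polarDensity (μ.restrict T) =ᵐ[μ.variation.restrict T] polarDensity μ := by
  have hf := integrable_polarDensity (μ.restrict T)
  have hμT := withDensityᵥ_polarDensity (μ.restrict T)
  rw [VectorMeasure.variation_restrict hT] at hf hμT
  refine hf.ae_eq_of_withDensityᵥ_eq (integrable_polarDensity μ).integrableOn ?_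
  rw [hμT, ← restrict_withDensityᵥ (integrable_polarDensity μ) hT, withDensityᵥ_polarDensity]

end PolarDensity

section Field

variable {μ ν : Magnetization} {T : Set R3} {x : R3}

theorem integrable_inv_norm_sub_pow {E : Type*} [NormedAddCommGroup E] [MeasurableSpace E]
    [BorelSpace E] [SecondCountableTopology E] {m : Measure E} [IsFiniteMeasure m] {T : Set E}
    {x : E} (hT : IsClosed T) (hm : m Tᶜ = 0) (hx : x ∉ T) (k : ℕ) :
    Integrable (fun y => 1 / ‖x - y‖ ^ k) m := by
  obtain ⟨δ, hδ, hdist⟩ := exists_pos_le_norm_sub_of_mem_ball hT hx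
  refine Integrable.of_bound (Measurable.aestronglyMeasurable (by fun_prop)) (1 / δ ^ k) ?_
  filter_upwards [mem_ae_iff.2 hm] with y hy
  have hδy := hdist x (mem_ball_self hδ) y hy
  rw [Real.norm_of_nonneg (by positivity)]
  gcongr

theorem integrable_smul_rankOne {E : Type*} [NormedAddCommGroup E] [InnerProductSpace ℝ E]
    [MeasurableSpace E] [BorelSpace E] [SecondCountableTopology E] {m : Measure E}
    [IsFiniteMeasure m] {T : Set E} {x : E} (hT : IsClosed T) (hm : m Tᶜ = 0) (hx : x ∉ T) :
    Integrable (fun y => (1 / ‖x - y‖ ^ 5) • rankOne ℝ (x - y) (x - y)) m := by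
  have hrank : Continuous fun y : E => rankOne ℝ (x - y) (x - y) :=
    ((rankOne ℝ).continuous.comp (continuous_sub_left x)).clm_apply (continuous_sub_left x)
  have hcoeff : Measurable fun y : E => 1 / ‖x - y‖ ^ 5 := by fun_prop
  refine (integrable_inv_norm_sub_pow hT hm hx 3).mono
    (hcoeff.aestronglyMeasurable.smul hrank.aestronglyMeasurable) ?_
  filter_upwards [mem_ae_iff.2 hm] with y hy
  have : 0 < ‖x - y‖ := norm_sub_pos_iff.2 fun hxy => hx (hxy ▸ hy)
  rw [norm_smul, norm_rankOne, Real.norm_of_nonneg (by positivity),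
    Real.norm_of_nonneg (by positivity)]
  field_simp
  rfl

theorem magneticField_sub (hT : IsClosed T) (hμ : μ.variation Tᶜ = 0) (hν : ν.variation Tᶜ = 0)
    (hx : x ∉ T) : magneticField (μ - ν) x = magneticField μ x - magneticField ν x := by
  rw [magneticField, VectorMeasure.integral_sub_vectorMeasure
      (integrable_inv_norm_sub_pow hT hμ hx 3) (integrable_inv_norm_sub_pow hT hν hx 3),
    VectorMeasure.integral_sub_vectorMeasure (integrable_smul_rankOne hT hμ hx)
      (integrable_smul_rankOne hT hν hx), magneticField, magneticField, ← smul_sub]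
  congr 1
  rw [smul_sub]
  abel

theorem toDualMap_magneticField (hT : IsClosed T) (hμ : μ.variation Tᶜ = 0) (hx : x ∉ T) :
    toDualMap ℝ R3 (magneticField μ x) =
      magneticConstant • kernelIntegral dipoleKernel μ.variation (polarDensity μ) x := by
  have hcube := integrable_inv_norm_sub_pow hT hμ hx 3
  have hrank := integrable_smul_rankOne hT hμ hx
  have hcube' := integrable_pairing_polarDensity (.lsmul ℝ ℝ) hcube
  have hrank' :=
    (integrable_pairing_polarDensity (.id ℝ (R3 →L[ℝ] R3)) hrank).fun_smul (3 : ℝ)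
  have hkernel := integrable_kernel isHomogeneousKernel_dipoleKernel (integrable_polarDensity μ)
    hT hμ hx
  ext v
  rw [toDualMap_apply_apply, magneticField, vectorIntegral_eq_integral_polarDensity _ hcube,
    vectorIntegral_eq_integral_polarDensity _ hrank, ← integral_smul, real_inner_comm,
    inner_smul_right, inner_sub_right, ← integral_inner hcube', ← integral_inner hrank',
    ← integral_sub (hcube'.const_inner v) (hrank'.const_inner v), neg_mul, ← mul_neg,
    ← integral_neg, smul_apply, kernelIntegral, ContinuousLinearMap.integral_apply hkernel,
    smul_eq_mul]
  congr 1
  refine integral_congr_ae ?_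
  filter_upwards [mem_ae_iff.2 hμ] with y hy
  have hxy : x - y ≠ 0 := sub_ne_zero.2 fun hxy : x = y => hx (hxy ▸ hy)
  rw [dipoleKernel_apply_eq_neg_inner hxy, inner_sub_right]
  rfl

theorem magneticField_eq_zero_iff (hT : IsClosed T) (hμ : μ.variation Tᶜ = 0) (hx : x ∉ T) :
    magneticField μ x = 0 ↔
      kernelIntegral dipoleKernel μ.variation (polarDensity μ) x = 0 := by
  have hc : magneticConstant ≠ 0 := by norm_num [magneticConstant]
  rw [← norm_eq_zero, ← (toDualMap ℝ R3).norm_map, norm_eq_zero,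
    toDualMap_magneticField hT hμ hx, smul_eq_zero_iff_right hc]

theorem variation_restrict_compl_self (μ : Magnetization) (hT : MeasurableSet T) :
    (μ.restrict T).variation Tᶜ = 0 := by
  rw [VectorMeasure.variation_restrict hT, Measure.restrict_apply hT.compl, compl_inter_self,
    measure_empty]

theorem magneticField_restrict_eq_zero_iff (hT : IsClosed T) (hx : x ∉ T) :
    magneticField (μ.restrict T) x = 0 ↔
      kernelIntegral dipoleKernel (μ.variation.restrict T) (polarDensity μ) x = 0 := by
  rw [magneticField_eq_zero_iff hT (variation_restrict_compl_self μ hT.measurableSet) hx,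
    VectorMeasure.variation_restrict hT.measurableSet, kernelIntegral, kernelIntegral,
    integral_congr_ae ((polarDensity_restrict μ hT.measurableSet).mono fun y hy => by rw [hy])]

end Field

section Direction

variable {μ ν : Magnetization} {T B : Set R3} {v : R3}

theorem tvNorm_eq_zero_iff : tvNorm μ = 0 ↔ μ = 0 := by
  rw [tvNorm, Measure.measure_univ_eq_zero, VectorMeasure.variation_eq_zero]

theorem enorm_apply_univ_le_tvNorm (μ : Magnetization) : ‖μ univ‖ₑ ≤ tvNorm μ :=
  μ.enorm_measure_le_variation univ

theorem HasDirection.apply_eq_smul (h : HasDirection μ v) (hB : MeasurableSet B) :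
    μ B = μ.variation.real B • v := by
  rw [apply_eq_setIntegral_polarDensity μ hB, integral_congr_ae (ae_restrict_of_ae h),
    setIntegral_const]

theorem hasDirection_zero (v : R3) : HasDirection 0 v := by
  simp [HasDirection]

theorem HasDirection.norm_eq_one (h : HasDirection μ v) (hμ : μ ≠ 0) : ‖v‖ = 1 := by
  have : (ae μ.variation).NeBot := ae_neBot.2 (mt VectorMeasure.variation_eq_zero.1 hμ)
  obtain ⟨x, hx, hnorm⟩ := (h.and (norm_polarDensity_ae_eq_one μ)).exists
  rwa [hx] at hnorm

theorem HasDirection.tvNorm_eq_enorm_apply_univ (h : HasDirection μ v) :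
    tvNorm μ = ‖μ univ‖ₑ := by
  rcases eq_or_ne μ 0 with rfl | hμ
  · simp [tvNorm]
  · have hv : ‖v‖ₑ = 1 := by rw [← ofReal_norm, h.norm_eq_one hμ, ENNReal.ofReal_one]
    rw [h.apply_eq_smul .univ, enorm_smul, hv, mul_one, Real.enorm_of_nonneg measureReal_nonneg,
      ofReal_measureReal, tvNorm]

theorem hasDirection_of_inner_eq_variation (hv : ‖v‖ = 1)
    (h : inner ℝ v (μ univ) = μ.variation.real univ) : HasDirection μ v := by
  have hint : Integrable (fun x => inner ℝ v (polarDensity μ x)) μ.variation :=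
    (integrable_polarDensity μ).const_inner v
  have hle : ∀ᵐ x ∂μ.variation, inner ℝ v (polarDensity μ x) ≤ 1 := by
    filter_upwards [norm_polarDensity_ae_eq_one μ] with x hx
    simpa only [hv, hx, mul_one] using real_inner_le_norm v (polarDensity μ x)
  have hzero : ∫ x, (1 - inner ℝ v (polarDensity μ x)) ∂μ.variation = 0 := by
    rw [integral_sub (integrable_const 1) hint, integral_inner (integrable_polarDensity μ),
      ← setIntegral_univ (f := polarDensity μ), ← apply_eq_setIntegral_polarDensity μ .univ, h,
      integral_const, smul_eq_mul, mul_one, sub_self]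
  have heq := (integral_eq_zero_iff_of_nonneg_ae (hle.mono fun _ => sub_nonneg.2)
    ((integrable_const 1).sub hint)).1 hzero
  filter_upwards [heq, norm_polarDensity_ae_eq_one μ] with x hx hnorm
  exact ((inner_eq_one_iff_of_norm_eq_one hv hnorm).1 (sub_eq_zero.1 hx).symm).symm

theorem IsUniDirectional.tvNorm_le (hμ : IsUniDirectional μ) (h : ν univ = μ univ) :
    tvNorm μ ≤ tvNorm ν := by
  obtain ⟨v, hv⟩ := hμ
  rw [hv.tvNorm_eq_enorm_apply_univ, ← h]
  exact enorm_apply_univ_le_tvNorm ν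

theorem IsUniDirectional.tvNorm_eq_iff (hμ : IsUniDirectional μ) (h : ν univ = μ univ) :
    tvNorm μ = tvNorm ν ↔ IsUniDirectionalSame μ ν := by
  refine ⟨fun htv => ?_, fun ⟨v, hv, hv'⟩ => ?_⟩
  · obtain ⟨v, hv⟩ := hμ
    refine ⟨v, hv, ?_⟩
    rcases eq_or_ne μ 0 with rfl | hμ
    · rw [tvNorm_eq_zero_iff.1 (htv.symm.trans (tvNorm_eq_zero_iff.2 rfl))]
      exact hasDirection_zero v
    · refine hasDirection_of_inner_eq_variation (hv.norm_eq_one hμ) ?_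
      rw [h, hv.apply_eq_smul .univ, inner_smul_right,
        inner_self_eq_one_of_norm_eq_one (hv.norm_eq_one hμ), mul_one]
      exact congrArg ENNReal.toReal htv
  · rw [hv.tvNorm_eq_enorm_apply_univ, hv'.tvNorm_eq_enorm_apply_univ, h]

end Direction

section Partition

variable {ι : Type*} {S : Set R3} {T : ι → Set R3} {μ ν : Magnetization}

theorem variation_compl_eq_zero (h : μ ∈ magnetizationsOn S) : μ.variation Sᶜ = 0 :=
  measure_mono_null (compl_subset_compl.2 h) Measure.measure_compl_support

theorem variation_sub_compl_eq_zero (hμ : μ.variation Sᶜ = 0) (hν : ν.variation Sᶜ = 0) :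
    (μ - ν).variation Sᶜ = 0 := by
  refine nonpos_iff_eq_zero.1 ((VectorMeasure.variation_sub_le _).trans ?_)
  rw [Measure.add_apply, hμ, hν, add_zero]

theorem sum_eq_sum_iff_of_le_of_ne_top [Fintype ι] {f g : ι → ENNReal} (hle : ∀ i, f i ≤ g i)
    (hg : ∀ i, g i ≠ ⊤) : ∑ i, f i = ∑ i, g i ↔ ∀ i, f i = g i := by
  lift f to ι → NNReal using fun i => ((hle i).trans_lt (hg i).lt_top).ne
  lift g to ι → NNReal using hg
  simp only [ENNReal.coe_le_coe] at hle
  simpa only [← ENNReal.ofNNReal_finsetSum, ENNReal.coe_inj, Finset.mem_univ, true_implies] using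
    Finset.sum_eq_sum_iff_of_le (s := .univ) fun i _ => hle i

theorem tvNorm_ne_top (μ : Magnetization) : tvNorm μ ≠ ⊤ :=
  measure_ne_top _ _

theorem tvNorm_eq_sum_restrict [Fintype ι] (hT : ∀ i, MeasurableSet (T i))
    (hdisj : Pairwise (Function.onFun Disjoint T)) (hμ : μ.variation (⋃ i, T i)ᶜ = 0) :
    tvNorm μ = ∑ i, tvNorm (μ.restrict (T i)) := by
  rw [tvNorm, ← measure_add_measure_compl (MeasurableSet.iUnion hT), hμ, add_zero,
    measure_iUnion hdisj hT, tsum_fintype]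
  refine Finset.sum_congr rfl fun i _ => ?_
  rw [tvNorm, VectorMeasure.variation_restrict (hT i), Measure.restrict_apply_univ]

theorem tvNorm_le_of_forall_isUniDirectional_restrict [Finite ι] (hT : ∀ i, MeasurableSet (T i))
    (hdisj : Pairwise (Function.onFun Disjoint T)) (hμ : μ.variation (⋃ i, T i)ᶜ = 0)
    (hν : ν.variation (⋃ i, T i)ᶜ = 0) (hμ_uni : ∀ i, IsUniDirectional (μ.restrict (T i)))
    (h : ∀ i, ν.restrict (T i) univ = μ.restrict (T i) univ) : tvNorm μ ≤ tvNorm ν := by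
  have := Fintype.ofFinite ι
  rw [tvNorm_eq_sum_restrict hT hdisj hμ, tvNorm_eq_sum_restrict hT hdisj hν]
  exact Finset.sum_le_sum fun i _ => (hμ_uni i).tvNorm_le (h i)

theorem tvNorm_eq_iff_forall_isUniDirectionalSame_restrict [Finite ι]
    (hT : ∀ i, MeasurableSet (T i)) (hdisj : Pairwise (Function.onFun Disjoint T))
    (hμ : μ.variation (⋃ i, T i)ᶜ = 0) (hν : ν.variation (⋃ i, T i)ᶜ = 0)
    (hμ_uni : ∀ i, IsUniDirectional (μ.restrict (T i)))
    (h : ∀ i, ν.restrict (T i) univ = μ.restrict (T i) univ) :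
    tvNorm μ = tvNorm ν ↔ ∀ i, IsUniDirectionalSame (μ.restrict (T i)) (ν.restrict (T i)) := by
  have := Fintype.ofFinite ι
  rw [tvNorm_eq_sum_restrict hT hdisj hμ, tvNorm_eq_sum_restrict hT hdisj hν,
    sum_eq_sum_iff_of_le_of_ne_top (fun i => (hμ_uni i).tvNorm_le (h i)) fun _ => tvNorm_ne_top _]
  exact forall_congr' fun i => (hμ_uni i).tvNorm_eq_iff (h i)

theorem exists_isClosed_disjoint_union_eq_iUnion [Finite ι] {X : Type*} [TopologicalSpace X]
    {T : ι → Set X} (hT : ∀ i, IsClosed (T i)) (hdisj : Pairwise (Function.onFun Disjoint T))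
    (i : ι) : ∃ A, IsClosed A ∧ Disjoint (T i) A ∧ T i ∪ A = ⋃ j, T j := by
  refine ⟨⋃ j : {j // j ≠ i}, T j, isClosed_iUnion_of_finite fun j => hT j,
    disjoint_iUnion_right.2 fun j => hdisj j.2.symm, ?_⟩
  rw [iUnion_subtype]
  exact (iSup_split_single T i).symm

end Partition

section Separation

variable {μ ν σ : Magnetization} {S T A : Set R3} {x : R3}

theorem sEquivalent_iff_magneticField_sub_eq_zero (hT : IsClosed T) (hμ : μ.variation Tᶜ = 0)
    (hν : ν.variation Tᶜ = 0) : SEquivalent T μ ν ↔ ∀ x ∉ T, magneticField (μ - ν) x = 0 :=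
  forall₂_congr fun _ hx => by rw [magneticField_sub hT hμ hν hx, sub_eq_zero]

theorem magneticField_restrict_eq_zero_of_isCompact (hT : IsCompact T) (hA : IsCompact A)
    (hdisj : Disjoint T A) (hσ : σ.variation (T ∪ A)ᶜ = 0)
    (hzero : ∀ x ∉ T ∪ A, magneticField σ x = 0) (hx : x ∉ T) :
    magneticField (σ.restrict T) x = 0 :=
  (magneticField_restrict_eq_zero_iff hT.isClosed hx).2 <|
    kernelIntegral_restrict_eq_zero_of_isCompact (by norm_num) isHomogeneousKernel_dipoleKernel
      (harmonicOnNhd_dipoleKernel finrank_euclideanSpace_fin) (integrable_polarDensity σ) hT hA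
      hdisj hσ
      (fun z hz => (magneticField_eq_zero_iff (hT.union hA).isClosed hσ hz).1 (hzero z hz)) x hx

theorem apply_univ_eq_zero_of_isCompact (hT : IsCompact T) (hσ : σ.variation Tᶜ = 0)
    (hzero : ∀ x ∉ T, magneticField σ x = 0) : σ univ = 0 := by
  rw [apply_eq_setIntegral_polarDensity σ .univ, setIntegral_univ]
  exact eq_zero_of_dipoleKernel_apply_eq_zero fun z hz =>
    kernel_apply_integral_eq_zero_of_isCompact isHomogeneousKernel_dipoleKernel
      (integrable_polarDensity σ) hT hσ
      (fun x hx => (magneticField_eq_zero_iff hT.isClosed hσ hx).1 (hzero x hx)) hz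

theorem isDivFree_of_isSlender (hS : IsSlender S) (hσ : σ.variation Sᶜ = 0)
    (hzero : ∀ x ∉ S, magneticField σ x = 0) : IsDivFree σ.variation (polarDensity σ) :=
  isDivFree_of_flipDeriv_eq_zero (μ := volume) finrank_euclideanSpace_fin
    (integrable_polarDensity σ) hS.1 hσ hS.2.1 hS.2.2
    fun x hx => (magneticField_eq_zero_iff hS.1 hσ hx).1 (hzero x hx)

theorem isDivFree_restrict (hdiv : IsDivFree σ.variation (polarDensity σ)) (hT : IsClosed T)
    (hA : IsClosed A) (hdisj : Disjoint T A) (hσ : σ.variation (T ∪ A)ᶜ = 0) :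
    IsDivFree (σ.restrict T).variation (polarDensity (σ.restrict T)) := fun φ hφ hφc => by
  rw [VectorMeasure.variation_restrict hT.measurableSet,
    integral_congr_ae ((polarDensity_restrict σ hT.measurableSet).mono fun y hy => by rw [hy])]
  exact hdiv.restrict hT hA hdisj hσ φ hφ hφc

theorem magneticField_eq_zero_of_isDivFree (hdiv : IsDivFree σ.variation (polarDensity σ))
    (hT : IsClosed T) (hσ : σ.variation Tᶜ = 0) (hx : x ∉ T) : magneticField σ x = 0 :=
  (magneticField_eq_zero_iff hT hσ hx).2 <|
    hdiv.kernelIntegral_flipDeriv_fderiv_eq_zero isHomogeneousKernel_newtonKernel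
      (integrable_polarDensity σ) hT hσ hx

theorem apply_univ_eq_zero_of_isDivFree (hdiv : IsDivFree σ.variation (polarDensity σ)) :
    σ univ = 0 := by
  rw [apply_eq_setIntegral_polarDensity σ .univ, setIntegral_univ]
  exact hdiv.integral_eq_zero (integrable_polarDensity σ)

theorem restrict_silent_of_isCompact_or_isSlender (hT : IsClosed T) (hA : IsClosed A)
    (hdisj : Disjoint T A) (hTA : IsCompact (T ∪ A) ∨ IsSlender (T ∪ A))
    (hσ : σ.variation (T ∪ A)ᶜ = 0) (hzero : ∀ x ∉ T ∪ A, magneticField σ x = 0) :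
    (∀ x ∉ T, magneticField (σ.restrict T) x = 0) ∧ σ.restrict T univ = 0 := by
  have hσT := variation_restrict_compl_self σ hT.measurableSet
  rcases hTA with hcompact | hslender
  · have hTc : IsCompact T := hcompact.of_isClosed_subset hT subset_union_left
    have hAc : IsCompact A := hcompact.of_isClosed_subset hA subset_union_right
    have hfield : ∀ x ∉ T, magneticField (σ.restrict T) x = 0 := fun _ =>
      magneticField_restrict_eq_zero_of_isCompact hTc hAc hdisj hσ hzero
    exact ⟨hfield, apply_univ_eq_zero_of_isCompact hTc hσT hfield⟩
  · have hdiv := isDivFree_restrict (isDivFree_of_isSlender hslender hσ hzero) hT hA hdisj hσ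
    exact ⟨fun _ => magneticField_eq_zero_of_isDivFree hdiv hT hσT,
      apply_univ_eq_zero_of_isDivFree hdiv⟩

theorem restrict_iUnion_silent_of_isCompact_or_isSlender {ι : Type*} [Finite ι]
    {T : ι → Set R3} (hT : ∀ i, IsClosed (T i)) (hdisj : Pairwise (Function.onFun Disjoint T))
    (hS : IsCompact (⋃ i, T i) ∨ IsSlender (⋃ i, T i)) (hσ : σ.variation (⋃ i, T i)ᶜ = 0)
    (hzero : ∀ x ∉ ⋃ i, T i, magneticField σ x = 0) (i : ι) :
    (∀ x ∉ T i, magneticField (σ.restrict (T i)) x = 0) ∧ σ.restrict (T i) univ = 0 := by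
  obtain ⟨A, hA, hTA, hunion⟩ := exists_isClosed_disjoint_union_eq_iUnion hT hdisj i
  rw [← hunion] at hS hσ hzero
  exact restrict_silent_of_isCompact_or_isSlender (hT i) hA hTA hS hσ hzero

end Separation

section Uniqueness

variable {σ μ ν : Magnetization} {T : Set R3} {v : R3}

theorem ae_eq_inner_smul_of_forall_setIntegral_eq_smul {X E : Type*} [MeasurableSpace X]
    [NormedAddCommGroup E] [InnerProductSpace ℝ E] [CompleteSpace E] {m : Measure X} {f : X → E}
    {v : E} (hf : Integrable f m) (hv : ‖v‖ = 1)
    (h : ∀ B, MeasurableSet B → ∃ c : ℝ, ∫ x in B, f x ∂m = c • v) :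
    f =ᵐ[m] fun x => inner ℝ v (f x) • v := by
  refine hf.ae_eq_of_forall_setIntegral_eq _ _ ((hf.const_inner v).smul_const v) fun B hB _ => ?_
  obtain ⟨c, hc⟩ := h B hB
  rw [integral_smul_const, integral_inner hf.integrableOn, hc, inner_smul_right,
    inner_self_eq_one_of_norm_eq_one hv, mul_one]

theorem eq_zero_of_isDivFree_of_forall_apply_eq_smul
    (hdiv : IsDivFree σ.variation (polarDensity σ)) (hv : ‖v‖ = 1)
    (h : ∀ B, MeasurableSet B → ∃ c : ℝ, σ B = c • v) : σ = 0 := by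
  have hσ := integrable_polarDensity σ
  have hf : polarDensity σ =ᵐ[σ.variation] fun x => inner ℝ v (polarDensity σ x) • v := by
    refine ae_eq_inner_smul_of_forall_setIntegral_eq_smul hσ hv fun B hB => ?_
    rw [← apply_eq_setIntegral_polarDensity σ hB]
    exact h B hB
  have hdiv' : IsDivFree σ.variation fun x => inner ℝ v (polarDensity σ x) • v :=
    fun φ hφ hφc => by
      rw [← hdiv φ hφ hφc]
      exact integral_congr_ae (hf.mono fun x hx => congrArg (fderiv ℝ φ x) hx.symm)
  have hcoeff := hdiv'.ae_eq_zero_of_smul_const (hσ.const_inner v)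
    (norm_ne_zero_iff.1 (hv ▸ one_ne_zero))
  refine eq_zero_of_polarDensity_ae_eq_zero ?_
  filter_upwards [hf, hcoeff] with x hx hcoeffx
  rw [hx, hcoeffx, Pi.zero_apply, zero_smul, Pi.zero_apply]

theorem IsUniDirectionalSame.sub_eq_zero_of_isDivFree (h : IsUniDirectionalSame μ ν)
    (hdiv : IsDivFree (ν - μ).variation (polarDensity (ν - μ))) : ν - μ = 0 := by
  obtain ⟨v, hμ, hν⟩ := h
  by_cases hzero : μ = 0 ∧ ν = 0
  · rw [hzero.1, hzero.2, sub_zero]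
  have hv : ‖v‖ = 1 := (not_and_or.1 hzero).elim hμ.norm_eq_one hν.norm_eq_one
  refine eq_zero_of_isDivFree_of_forall_apply_eq_smul hdiv hv fun B hB =>
    ⟨ν.variation.real B - μ.variation.real B, ?_⟩
  rw [sub_apply, hν.apply_eq_smul hB, hμ.apply_eq_smul hB, sub_smul]

theorem eq_of_forall_isUniDirectionalSame_of_isSlender {ι : Type*} [Finite ι]
    {T : ι → Set R3} (hT : ∀ i, IsClosed (T i)) (hdisj : Pairwise (Function.onFun Disjoint T))
    (hS : IsSlender (⋃ i, T i)) (hσ : (ν - μ).variation (⋃ i, T i)ᶜ = 0)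
    (hzero : ∀ x ∉ ⋃ i, T i, magneticField (ν - μ) x = 0)
    (hdir : ∀ i, IsUniDirectionalSame (μ.restrict (T i)) (ν.restrict (T i))) : μ = ν := by
  have hpiece : ∀ i, (ν - μ).restrict (T i) = 0 := fun i => by
    obtain ⟨A, hA, hTA, hunion⟩ := exists_isClosed_disjoint_union_eq_iUnion hT hdisj i
    have hdiv := isDivFree_restrict (isDivFree_of_isSlender hS hσ hzero) (hT i) hA hTA
      (hunion ▸ hσ)
    rw [VectorMeasure.restrict_sub] at hdiv ⊢
    exact (hdir i).sub_eq_zero_of_isDivFree hdiv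
  have := Fintype.ofFinite ι
  refine (sub_eq_zero.1 (tvNorm_eq_zero_iff.1 ?_)).symm
  rw [tvNorm_eq_sum_restrict (fun i => (hT i).measurableSet) hdisj hσ]
  exact Finset.sum_eq_zero fun i _ => tvNorm_eq_zero_iff.2 (hpiece i)

end Uniqueness

end Magnetostatics

end

theorem mainTheorem3 (n : ℕ) (S : Set Magnetostatics.R3) (T : Fin n → Set Magnetostatics.R3)
    (hT_closed : ∀ i, IsClosed (T i))
    (hT_disjoint : ∀ i j, i ≠ j → Disjoint (T i) (T j))
    (hS : S = ⋃ i, T i)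
    (hS_type : IsCompact S ∨ Magnetostatics.IsSlender S)
    (μ : Magnetostatics.Magnetization) (hμ : μ ∈ Magnetostatics.magnetizationsOn S)
    (hμ_uni : ∀ i, Magnetostatics.IsUniDirectional (μ.restrict (T i)))
    (ν : Magnetostatics.Magnetization) (hν : ν ∈ Magnetostatics.magnetizationsOn S)
    (hμν : Magnetostatics.SEquivalent S ν μ) :
    (∀ i, Magnetostatics.SEquivalent (T i) (ν.restrict (T i)) (μ.restrict (T i))) ∧
    Magnetostatics.tvNorm μ ≤ Magnetostatics.tvNorm ν ∧
    (Magnetostatics.tvNorm μ = Magnetostatics.tvNorm ν ↔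
      ∀ i, Magnetostatics.IsUniDirectionalSame (μ.restrict (T i)) (ν.restrict (T i))) ∧
    (Magnetostatics.IsSlender S → Magnetostatics.tvNorm μ = Magnetostatics.tvNorm ν → μ = ν) := by
  open Magnetostatics in
  subst hS
  have hT_meas := fun i => (hT_closed i).measurableSet
  have hμS := variation_compl_eq_zero hμ
  have hνS := variation_compl_eq_zero hν
  have hσS := variation_sub_compl_eq_zero hνS hμS
  have hsilent := (sEquivalent_iff_magneticField_sub_eq_zero
    (isClosed_iUnion_of_finite hT_closed) hνS hμS).1 hμν
  have hpiece := restrict_iUnion_silent_of_isCompact_or_isSlender hT_closed hT_disjoint hS_type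
    hσS hsilent
  simp only [VectorMeasure.restrict_sub, sub_apply, sub_eq_zero] at hpiece
  have hmoment := fun i => (hpiece i).2
  have heq := tvNorm_eq_iff_forall_isUniDirectionalSame_restrict hT_meas hT_disjoint hμS hνS
    hμ_uni hmoment
  refine ⟨fun i => ?_, ?_, heq, fun hS htv => ?_⟩
  · exact (sEquivalent_iff_magneticField_sub_eq_zero (hT_closed i)
      (variation_restrict_compl_self ν (hT_meas i))
      (variation_restrict_compl_self μ (hT_meas i))).2 (hpiece i).1
  · exact tvNorm_le_of_forall_isUniDirectional_restrict hT_meas hT_disjoint hμS hνS hμ_uni hmoment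
  · exact eq_of_forall_isUniDirectionalSame_of_isSlender hT_closed hT_disjoint hS hσS hsilent
      (heq.1 htv)
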